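/- Let $\tau,z\in\mathbb C$ and let $\Omega=\begin{pmatrix}\tau&z\\ z&\tau\end{pmatrix}$ have positive definite imaginary part (equivalently $\operatorname{Im}\tau>|\operatorname{Im}z|$). Let $L_\Omega=\mathbb Z^{2}\Omega+\mathbb Z^{2}\subset\mathbb C^2$ (row vectors), with $\mathbb Z$-basis $e_1=(\tau,z)$, $e_2=(z,\tau)$, $e_3=(1,0)$, $e_4=(0,1)$, and let $A_\Omega=\mathbb C^2/L_\Omega$. Suppose that $\operatorname{Im}(2\tau+z)$ and $\operatorname{Im}(\tau+2z)$ are integers. Let $$H_*(v,w)=2v_1\bar w_1+2v_2\bar w_2+v_1\bar w_2+v_2\bar w_1\qquad(v,w\in\mathbb C^2)$$ and $E_*=\operatorname{Im}H_*$. Then: 1. $H_*$ is a positive definite Riemann form for $A_\Omega$, that is, a nondegenerate (and positive definite) Hermitian form such that $E_*$ is integral valued on $L_\Omega\times L_\Omega$. 2. There are semi-characters for $H_*$, that is, maps $\chi:L_\Omega\to\{t\in\mathbb C:|t|=1\}$ with $\chi(\alpha+\beta)=\chi(\alpha)\chi(\beta)e^{i\pi E_*(\alpha,\beta)}$ for all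 $\alpha,\beta\in L_\Omega$. 3. For every such semi-character $\chi_*$ let $L(H_*,\chi_*)$ be the holomorphic line bundle on $A_\Omega$ obtained as the quotient of $\mathbb C^2\times\mathbb C$ by the action $(v,\xi)\mapsto\bigl(v+\alpha,\ \chi_*(\alpha)e^{\pi H_*(v,\alpha)+\frac{\pi}{2}H_*(\alpha,\alpha)}\,\xi\bigr)$ of $\alpha\in L_\Omega$. Then $L(H_*,\chi_*)$ is ample, and for every $n\ge 3$ the global holomorphic sections of $L(H_*,\chi_*)^{\otimes n}$ embed $A_\Omega$ as a closed complex submanifold of a projective space. Moreover $H^0(A_\Omega,L(H_*,\chi_*))$ is finite dimensional and $$\dim H^0(A_\Omega,L(H_*,\chi_*))=\sqrt{\det E_*}=3\left((\operatorname{Im}\tau)^2-(\operatorname{Im}z)^2\right),$$ where $\det E_*$ is the determinant of the matrix $(E_*(e_i,e_j))_{1\le i,j\le 4}$. -/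

import Mathlib

namespace SpecialAbelianSurface

open Matrix LinearAlgebra.Projectivization
open scoped ComplexConjugate

/-! ### The half space and the lattice -/

/-- The Siegel upper half plane of degree two. -/
def siegelUpperHalfPlane : Set (Matrix (Fin 2) (Fin 2) ℂ) :=
  {Ω | Ω = Ωᵀ ∧ (Ω.map Complex.im).PosDef}

/-- The action `M⟨Ω⟩ = (A Ω + B) (C Ω + D)⁻¹` of a real matrix `M` with blocks `A`, `B`, `C`, `D`. -/
noncomputable def moebius (M : Matrix (Fin 2 ⊕ Fin 2) (Fin 2 ⊕ Fin 2) ℝ)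
    (Ω : Matrix (Fin 2) (Fin 2) ℂ) : Matrix (Fin 2) (Fin 2) ℂ :=
  (M.toBlocks₁₁.map Complex.ofReal * Ω + M.toBlocks₁₂.map Complex.ofReal) *
    (M.toBlocks₂₁.map Complex.ofReal * Ω + M.toBlocks₂₂.map Complex.ofReal)⁻¹

/-- The matrix `Q = diag(q, q)`, where `q` exchanges the two coordinates. -/
def matrixQ : Matrix (Fin 2 ⊕ Fin 2) (Fin 2 ⊕ Fin 2) ℝ :=
  Matrix.fromBlocks !![0, 1; 1, 0] 0 0 !![0, 1; 1, 0]

/-- The points of the Siegel upper half plane that are fixed by `Q`. -/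
def specialHalfSpace : Set (Matrix (Fin 2) (Fin 2) ℂ) :=
  {Ω | Ω ∈ siegelUpperHalfPlane ∧ moebius matrixQ Ω = Ω}

/-- The lattice `ℤ² Ω + ℤ²` of row vectors in `ℂ²`. -/
def periodLattice (Ω : Matrix (Fin 2) (Fin 2) ℂ) : AddSubgroup (Fin 2 → ℂ) where
  carrier := {v | ∃ m n : Fin 2 → ℤ, v = (fun i => (m i : ℂ)) ᵥ* Ω + fun i => (n i : ℂ)}
  zero_mem' := ⟨0, 0, by ext i; simp [Matrix.vecMul, dotProduct]⟩
  add_mem' := by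
    rintro _ _ ⟨m, n, rfl⟩ ⟨m', n', rfl⟩
    refine ⟨m + m', n + n', ?_⟩
    ext i
    simp [Matrix.vecMul, dotProduct]
    ring
  neg_mem' := by
    rintro _ ⟨m, n, rfl⟩
    refine ⟨-m, -n, ?_⟩
    ext i
    simp [Matrix.vecMul, dotProduct]
    ring

/-- The vectors `e₁, e₂` (the rows of `Ω`) and `e₃ = (1, 0)`, `e₄ = (0, 1)`. -/
def periodVector (Ω : Matrix (Fin 2) (Fin 2) ℂ) : Fin 4 → Fin 2 → ℂ :=
  ![Ω 0, Ω 1, ![1, 0], ![0, 1]]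

theorem periodVector_mem (Ω : Matrix (Fin 2) (Fin 2) ℂ) (i : Fin 4) :
    periodVector Ω i ∈ periodLattice Ω := by
  fin_cases i
  · exact ⟨![1, 0], 0, by ext j; simp [periodVector, Matrix.vecMul, dotProduct]⟩
  · exact ⟨![0, 1], 0, by ext j; simp [periodVector, Matrix.vecMul, dotProduct]⟩
  · exact ⟨0, ![1, 0], by
      ext j; fin_cases j <;> simp [periodVector, Matrix.vecMul, dotProduct]⟩
  · exact ⟨0, ![0, 1], by
      ext j; fin_cases j <;> simp [periodVector, Matrix.vecMul, dotProduct]⟩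

theorem periodVector_sum (Ω : Matrix (Fin 2) (Fin 2) ℂ) (c : Fin 4 → ℤ) (j : Fin 2) :
    ((∑ i, c i • (⟨periodVector Ω i, periodVector_mem Ω i⟩ : periodLattice Ω) :
      periodLattice Ω) : Fin 2 → ℂ) j =
      c 0 * Ω 0 j + c 1 * Ω 1 j + c 2 * (![1, 0] : Fin 2 → ℂ) j
        + c 3 * (![0, 1] : Fin 2 → ℂ) j := by
  fin_cases j <;> simp [Fin.sum_univ_four, periodVector, Matrix.vecHead, Matrix.vecTail]

/-- The `ℤ`-basis `e₁, e₂, e₃, e₄` of the lattice `ℤ² Ω + ℤ²`. -/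
noncomputable def periodBasis (Ω : Matrix (Fin 2) (Fin 2) ℂ) (hΩ : Ω ∈ siegelUpperHalfPlane) :
    Module.Basis (Fin 4) ℤ (periodLattice Ω) :=
  Module.Basis.mk (v := fun i => (⟨periodVector Ω i, periodVector_mem Ω i⟩ : periodLattice Ω))
    (by
      rw [Fintype.linearIndependent_iff]
      intro c hc
      have key : ∀ j, (c 0 * Ω 0 j + c 1 * Ω 1 j + c 2 * (![1, 0] : Fin 2 → ℂ) j
        + c 3 * (![0, 1] : Fin 2 → ℂ) j : ℂ) = 0 := by
        intro j
        rw [← periodVector_sum, hc]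
        rfl
      have hdet := hΩ.2.det_pos
      rw [Matrix.det_fin_two] at hdet
      simp only [Matrix.map_apply] at hdet
      have k0 := key 0
      have k1 := key 1
      have i0 := congrArg Complex.im k0
      have i1 := congrArg Complex.im k1
      simp at i0 i1
      have h0 : (c 0 : ℝ) = 0 := by
        have : (c 0 : ℝ) *
            ((Ω 0 0).im * (Ω 1 1).im - (Ω 0 1).im * (Ω 1 0).im) = 0 := by
          linear_combination (Ω 1 1).im * i0 - (Ω 1 0).im * i1
        exact (mul_eq_zero.1 this).resolve_right hdet.ne'
      have h1 : (c 1 : ℝ) = 0 := by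
        have : (c 1 : ℝ) *
            ((Ω 0 0).im * (Ω 1 1).im - (Ω 0 1).im * (Ω 1 0).im) = 0 := by
          linear_combination (Ω 0 0).im * i1 - (Ω 0 1).im * i0
        exact (mul_eq_zero.1 this).resolve_right hdet.ne'
      have h0' : c 0 = 0 := by exact_mod_cast h0
      have h1' : c 1 = 0 := by exact_mod_cast h1
      simp [h0', h1'] at k0 k1
      intro i
      fin_cases i
      · exact h0'
      · exact h1'
      · exact k0
      · exact k1)
    (by
      rintro ⟨v, m, n, rfl⟩ -
      rw [Submodule.mem_span_range_iff_exists_fun]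
      refine ⟨![m 0, m 1, n 0, n 1], ?_⟩
      apply Subtype.ext
      ext j
      rw [periodVector_sum]
      fin_cases j <;> simp [Matrix.vecMul, dotProduct])

/-! ### Riemann forms, semi-characters, automorphic factors

In what follows `L` is a lattice in `ℂ²`, and `(Fin 2 → ℂ) ⧸ L` is the complex torus. -/

/-- Forms on `ℂ²` that are linear in the first and conjugate linear in the second variable. -/
abbrev SesqForm : Type := (Fin 2 → ℂ) →ₗ[ℂ] (Fin 2 → ℂ) →ₗ⋆[ℂ] ℂ

/-- A Riemann form for `ℂ² / L`: a nondegenerate Hermitian form whose imaginary part is integral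
on `L × L`. -/
structure IsRiemannForm (L : AddSubgroup (Fin 2 → ℂ)) (H : SesqForm) : Prop where
  hermitian : ∀ z w, H w z = conj (H z w)
  nondegenerate : H.Nondegenerate
  integral : ∀ α ∈ L, ∀ β ∈ L, ∃ k : ℤ, (H α β).im = k

/-- Positive definiteness of a form (for a Hermitian form, `H z z` is real). -/
def IsPositiveDefinite (H : SesqForm) : Prop := ∀ z, z ≠ 0 → 0 < (H z z).re

/-- Semi-characters of `L` with respect to `E = Im H`. -/
structure SemiCharacter (L : AddSubgroup (Fin 2 → ℂ)) (H : SesqForm) where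
  toFun : L → Circle
  map_add : ∀ α β : L, (toFun (α + β) : ℂ) =
    toFun α * toFun β * Complex.exp (Complex.I * Real.pi * ((H α β).im : ℝ))

/-- Automorphic factors of rank one: nowhere vanishing, holomorphic 1-cocycles of `L`. -/
structure AutomorphicFactor (L : AddSubgroup (Fin 2 → ℂ)) where
  toFun : L → (Fin 2 → ℂ) → ℂ
  ne_zero : ∀ α z, toFun α z ≠ 0
  holomorphic : ∀ α, Differentiable ℂ (toFun α)
  cocycle : ∀ (α β : L) (z : Fin 2 → ℂ),
    toFun (α + β) z = toFun α ((β : Fin 2 → ℂ) + z) * toFun β z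

variable {L : AddSubgroup (Fin 2 → ℂ)}

/-- The automorphic factor `J_{H,χ}(α, z) = χ(α) exp(π H(z, α) + (π / 2) H(α, α))`. -/
noncomputable def automorphicFactor {H : SesqForm} (hH : IsRiemannForm L H)
    (χ : SemiCharacter L H) : AutomorphicFactor L where
  toFun α z := χ.toFun α * Complex.exp (Real.pi * H z α + Real.pi / 2 * H α α)
  ne_zero α z := mul_ne_zero (Circle.coe_ne_zero _) (Complex.exp_ne_zero _)
  holomorphic α := by
    have h : Differentiable ℂ (fun z : Fin 2 → ℂ => H z α) :=
      (LinearMap.toContinuousLinearMap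
        ({ toFun := fun z => H z α, map_add' := by simp, map_smul' := by simp } :
          (Fin 2 → ℂ) →ₗ[ℂ] ℂ)).differentiable
    fun_prop
  cocycle α β z := by
    obtain ⟨k, hk⟩ := hH.integral α α.2 β β.2
    have h2 : H α β - H β α = 2 * Complex.I * k := by
      rw [hH.hermitian α β, Complex.sub_conj, hk]
      push_cast
      ring
    have h3 : H α β = H β α + 2 * Complex.I * k := by linear_combination h2
    rw [χ.map_add, hk]
    simp only [AddSubgroup.coe_add, map_add, LinearMap.add_apply]
    have e1 : Complex.exp (Complex.I * Real.pi * ((k : ℝ) : ℂ)) *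
        Complex.exp (Real.pi * (H z α + H z β) +
          Real.pi / 2 * (H α α + H β α + (H α β + H β β))) =
        Complex.exp (Real.pi * (H β α + H z α) + Real.pi / 2 * H α α) *
        Complex.exp (Real.pi * H z β + Real.pi / 2 * H β β) := by
      rw [← Complex.exp_add, ← Complex.exp_add, Complex.exp_eq_exp_iff_exists_int]
      refine ⟨k, ?_⟩
      rw [h3]
      push_cast
      ring
    linear_combination ((χ.toFun α : ℂ) * (χ.toFun β : ℂ)) * e1

/-- The automorphic factor `Jⁿ`; its line bundle is the `n`-th tensor power of that of `J`, since
tensor products of line bundles multiply the factors. -/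
def AutomorphicFactor.tensorPow (J : AutomorphicFactor L) (n : ℕ) : AutomorphicFactor L where
  toFun α z := J.toFun α z ^ n
  ne_zero α z := pow_ne_zero n (J.ne_zero α z)
  holomorphic α := (J.holomorphic α).pow n
  cocycle α β z := by rw [J.cocycle, mul_pow]

/-! ### The line bundle of an automorphic factor and its holomorphic sections -/

theorem AutomorphicFactor.zero (J : AutomorphicFactor L) (z : Fin 2 → ℂ) : J.toFun 0 z = 1 := by
  have h := J.cocycle 0 0 z
  simp only [add_zero, AddSubgroup.coe_zero, zero_add] at h
  exact (mul_right_cancel₀ (J.ne_zero 0 z) (by rw [one_mul]; exact h)).symm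

/-- The orbit relation of the action `ρ_α(z, ξ) = (z + α, J(α, z) ξ)` of `L` on `ℂ² × ℂ`. -/
def orbitSetoid (J : AutomorphicFactor L) : Setoid ((Fin 2 → ℂ) × ℂ) where
  r p q := ∃ α : L, q = (p.1 + α, J.toFun α p.1 * p.2)
  iseqv := by
    refine ⟨fun p => ⟨0, by simp [J.zero]⟩, ?_, ?_⟩
    · rintro ⟨z, ξ⟩ _ ⟨α, rfl⟩
      refine ⟨-α, ?_⟩
      have h := J.cocycle (-α) α z
      rw [neg_add_cancel, J.zero, add_comm (α : Fin 2 → ℂ)] at h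
      simp [← mul_assoc, ← h]
    · rintro ⟨z, ξ⟩ _ _ ⟨α, rfl⟩ ⟨β, rfl⟩
      refine ⟨β + α, ?_⟩
      have h := J.cocycle β α z
      rw [add_comm (α : Fin 2 → ℂ)] at h
      simp only [h, AddSubgroup.coe_add, Prod.mk.injEq]
      exact ⟨by abel, by ring⟩

/-- The total space of the line bundle defined by `J`: the quotient of `ℂ² × ℂ` by `L`. -/
def LineBundle (J : AutomorphicFactor L) : Type := Quotient (orbitSetoid J)

/-- The projection of the line bundle onto the torus `ℂ² / L`. -/
def LineBundle.proj (J : AutomorphicFactor L) : LineBundle J → (Fin 2 → ℂ) ⧸ L :=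
  Quotient.lift (fun p => (p.1 : (Fin 2 → ℂ) ⧸ L)) (by
    rintro ⟨z, ξ⟩ _ ⟨α, rfl⟩
    simp)

/-- The fibre of the line bundle over a point of the torus. -/
def Fiber (J : AutomorphicFactor L) (x : (Fin 2 → ℂ) ⧸ L) : Type :=
  {y : LineBundle J // LineBundle.proj J y = x}

/-- The class `[z, ξ]`, as a point of the fibre over the class of `z`. -/
def Fiber.mk (J : AutomorphicFactor L) (z : Fin 2 → ℂ) (ξ : ℂ) :
    Fiber J (z : (Fin 2 → ℂ) ⧸ L) :=
  ⟨Quotient.mk (orbitSetoid J) (z, ξ), rfl⟩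

theorem Fiber.bijective (J : AutomorphicFactor L) (x : (Fin 2 → ℂ) ⧸ L) (z : Fin 2 → ℂ)
    (hz : (z : (Fin 2 → ℂ) ⧸ L) = x) :
    Function.Bijective (fun ξ : ℂ =>
      (⟨Quotient.mk (orbitSetoid J) (z, ξ), hz⟩ : Fiber J x)) := by
  constructor
  · intro ξ η h
    obtain ⟨α, hα⟩ := Quotient.exact (congrArg Subtype.val h)
    simp only [Prod.mk.injEq] at hα
    have h0 : α = 0 := Subtype.ext (by simpa using hα.1.symm)
    rw [hα.2, h0, J.zero, one_mul]
  · rintro ⟨y, hy⟩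
    obtain ⟨⟨w, η⟩, rfl⟩ := Quotient.exists_rep y
    have hw : (w : (Fin 2 → ℂ) ⧸ L) = (z : (Fin 2 → ℂ) ⧸ L) := hy.trans hz.symm
    rw [QuotientAddGroup.eq] at hw
    refine ⟨J.toFun ⟨_, hw⟩ w * η, Subtype.ext (Quotient.sound ?_)⟩
    exact (orbitSetoid J).symm ⟨⟨_, hw⟩, by simp⟩

/-- The identification `ξ ↦ [z, ξ]` of `ℂ` with a fibre, for a chosen representative `z` of the
base point. -/
noncomputable def Fiber.equiv (J : AutomorphicFactor L) (x : (Fin 2 → ℂ) ⧸ L) :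
    Fiber J x ≃ ℂ :=
  (Equiv.ofBijective _ (Fiber.bijective J x x.out (QuotientAddGroup.out_eq' x))).symm

noncomputable instance (J : AutomorphicFactor L) (x : (Fin 2 → ℂ) ⧸ L) :
    AddCommGroup (Fiber J x) := (Fiber.equiv J x).addCommGroup

noncomputable instance (J : AutomorphicFactor L) (x : (Fin 2 → ℂ) ⧸ L) :
    Module ℂ (Fiber J x) := (Fiber.equiv J x).module ℂ

theorem Fiber.exists_equiv_mk (J : AutomorphicFactor L) (z : Fin 2 → ℂ) :
    ∃ c : ℂ, c ≠ 0 ∧ ∀ ξ, Fiber.equiv J z (Fiber.mk J z ξ) = c * ξ := by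
  have hw : ((z : (Fin 2 → ℂ) ⧸ L).out : (Fin 2 → ℂ) ⧸ L) = z := QuotientAddGroup.out_eq' _
  have hw' := hw.symm
  rw [QuotientAddGroup.eq] at hw'
  refine ⟨J.toFun ⟨_, hw'⟩ z, J.ne_zero _ _, fun ξ => ?_⟩
  rw [← Equiv.eq_symm_apply]
  refine Subtype.ext (Quotient.sound ⟨⟨_, hw'⟩, ?_⟩)
  simp

/-- The vector space structure of the fibres does not depend on the chosen representatives:
addition is `[z, ξ] + [z, η] = [z, ξ + η]` for every `z`. -/
theorem Fiber.mk_add (J : AutomorphicFactor L) (z : Fin 2 → ℂ) (ξ η : ℂ) :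
    Fiber.mk J z (ξ + η) = Fiber.mk J z ξ + Fiber.mk J z η := by
  obtain ⟨c, -, hc⟩ := Fiber.exists_equiv_mk J z
  apply (Fiber.equiv J z).injective
  rw [Equiv.add_def, Equiv.apply_symm_apply, hc, hc, hc, mul_add]

/-- Scalar multiplication is `c [z, ξ] = [z, c ξ]` for every `z`. -/
theorem Fiber.mk_smul (J : AutomorphicFactor L) (z : Fin 2 → ℂ) (a ξ : ℂ) :
    Fiber.mk J z (a * ξ) = a • Fiber.mk J z ξ := by
  obtain ⟨c, -, hc⟩ := Fiber.exists_equiv_mk J z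
  apply (Fiber.equiv J z).injective
  rw [Equiv.smul_def, Equiv.apply_symm_apply, hc, hc, smul_eq_mul]
  ring

theorem Fiber.mk_zero (J : AutomorphicFactor L) (z : Fin 2 → ℂ) : Fiber.mk J z 0 = 0 := by
  simpa using Fiber.mk_smul J z 0 0

/-- The space `H⁰` of global holomorphic sections of the line bundle defined by `J`. Since
`ℂ² × ℂ → LineBundle J` and `ℂ² → ℂ² / L` are holomorphic coverings, a section `s` is holomorphic
if and only if `s([z]) = [z, θ(z)]` with a holomorphic function `θ` on `ℂ²`. -/
def H0 (J : AutomorphicFactor L) : Submodule ℂ ((x : (Fin 2 → ℂ) ⧸ L) → Fiber J x) where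
  carrier := {s | ∃ θ : (Fin 2 → ℂ) → ℂ, Differentiable ℂ θ ∧
    ∀ z : Fin 2 → ℂ, s z = Fiber.mk J z (θ z)}
  zero_mem' := ⟨0, differentiable_const 0, fun z => (Fiber.mk_zero J z).symm⟩
  add_mem' := by
    rintro s t ⟨θ, hθ, hs⟩ ⟨η, hη, ht⟩
    exact ⟨θ + η, hθ.add hη, fun z => by
      rw [Pi.add_apply, hs, ht, Pi.add_apply, Fiber.mk_add]⟩
  smul_mem' := by
    rintro c s ⟨θ, hθ, hs⟩
    exact ⟨c • θ, hθ.const_smul c, fun z => by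
      rw [Pi.smul_apply, hs, Pi.smul_apply, smul_eq_mul, Fiber.mk_smul]⟩

/-! ### Projective embeddings and ampleness -/

/-- The topology of complex projective space: the quotient topology from `ℂᴺ⁺¹ \ {0}`. -/
noncomputable instance projectiveTopology (N : ℕ) : TopologicalSpace (ℙ ℂ (Fin (N + 1) → ℂ)) :=
  TopologicalSpace.coinduced
    (fun v : {v : Fin (N + 1) → ℂ // v ≠ 0} => Projectivization.mk ℂ v.1 v.2) inferInstance

/-- `φ : ℂ² / L → ℙᴺ` is a holomorphic immersion: near every point of `ℂ²` the composition of `φ`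
with the projection `ℂ² → ℂ² / L` is `[F]` for a holomorphic map `F` into `ℂᴺ⁺¹ \ {0}`, and the
differential of `[F]`, that is, the map that `dF` induces into the tangent space `ℂᴺ⁺¹ / ℂ F(z)`
of `ℙᴺ`, is injective. -/
def IsHolomorphicImmersion {N : ℕ} (φ : (Fin 2 → ℂ) ⧸ L → ℙ ℂ (Fin (N + 1) → ℂ)) : Prop :=
  ∀ z : Fin 2 → ℂ, ∃ F : (Fin 2 → ℂ) → Fin (N + 1) → ℂ,
    (∀ᶠ w in nhds z, DifferentiableAt ℂ F w ∧
      ∃ h : F w ≠ 0, φ w = Projectivization.mk ℂ (F w) h) ∧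
    ∀ v : Fin 2 → ℂ, (∃ c : ℂ, fderiv ℂ F z v = c • F z) → v = 0

/-- `φ` embeds the torus as a closed complex submanifold of `ℙᴺ`. -/
def IsClosedHolomorphicEmbedding {N : ℕ}
    (φ : (Fin 2 → ℂ) ⧸ L → ℙ ℂ (Fin (N + 1) → ℂ)) : Prop :=
  Topology.IsClosedEmbedding φ ∧ IsHolomorphicImmersion φ

/-- `φ(x) = [s₀(x) : ⋯ : s_N(x)]` for all `x`, where the sections `s₀, …, s_N` are read in an
arbitrary linear coordinate of the fibre over `x`; in particular they have no common zero. -/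
def IsMapOfSections {J : AutomorphicFactor L} {N : ℕ} (s : Fin (N + 1) → H0 J)
    (φ : (Fin 2 → ℂ) ⧸ L → ℙ ℂ (Fin (N + 1) → ℂ)) : Prop :=
  ∀ (x : (Fin 2 → ℂ) ⧸ L) (e : Fiber J x ≃ₗ[ℂ] ℂ),
    ∃ h : (fun i => e ((s i).1 x)) ≠ 0, φ x = Projectivization.mk ℂ (fun i => e ((s i).1 x)) h

/-- The global holomorphic sections embed the torus as a closed complex submanifold of a
projective space: `H⁰` has a finite, nonempty basis, and each such basis `s₀, …, s_N` defines an
embedding `x ↦ [s₀(x) : ⋯ : s_N(x)]`. -/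
def SectionsEmbed (J : AutomorphicFactor L) : Prop :=
  ∃ N : ℕ, Nonempty (Module.Basis (Fin (N + 1)) ℂ (H0 J)) ∧
    ∀ s : Module.Basis (Fin (N + 1)) ℂ (H0 J),
      ∃ φ : (Fin 2 → ℂ) ⧸ L → ℙ ℂ (Fin (N + 1) → ℂ),
        IsMapOfSections s φ ∧ IsClosedHolomorphicEmbedding φ

/-- Ampleness: the sections of some positive tensor power give a projective embedding. -/
def IsAmple (J : AutomorphicFactor L) : Prop := ∃ n : ℕ, 1 ≤ n ∧ SectionsEmbed (J.tensorPow n)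

/-! ### The form `H_*` -/

/-- `H_*(z, w) = 2 z₁ w̄₁ + 2 z₂ w̄₂ + z₁ w̄₂ + z₂ w̄₁`. -/
def HStar : SesqForm :=
  LinearMap.mk₂'ₛₗ (RingHom.id ℂ) (starRingEnd ℂ)
    (fun z w => 2 * z 0 * conj (w 0) + 2 * z 1 * conj (w 1) + z 0 * conj (w 1) + z 1 * conj (w 0))
    (by intros; simp; ring) (by intros; simp; ring) (by intros; simp; ring)
    (by intros; simp; ring)

/-- The matrix of `E = Im H` in a `ℤ`-basis of the lattice. -/
noncomputable def imMatrix (H : SesqForm) (b : Module.Basis (Fin 4) ℤ L) : Matrix (Fin 4) (Fin 4) ℝ :=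
  Matrix.of fun i j => (H (b i) (b j)).im

end SpecialAbelianSurface

open SpecialAbelianSurface

/-! Let S be the matrix with rows (2, 1) and (1, 2), and M the matrix with rows (A, B) and (B, A),
where A = Im(2τ + z) and B = Im(τ + 2z). Then M = S · Im Ω, and all matrices in sight are symmetric
circulants, so they commute. In the period basis E_* has the blocks 0, M, -M, 0 (`HStar_im`). Hence
E_* is integral, det E_* = (A² - B²)², and A² - B² = 3((Im τ)² - (Im z)²). A semi-character is
exp(πi · mMr) at mΩ + r.

Sections are entire functions with the automorphy of J (`thetaEquiv`). Division by the exponential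
of a quadratic polynomial makes them ℤ²-periodic, and translation by the rows of Ω then becomes a
recursion for the Fourier coefficients. Its solutions are a fixed Gaussian times a function on ℤ²
modulo the row lattice of nM (`exists_thetaParametrization`). The Gaussian decays because the
imaginary part of its quadratic form is (nS)⁻¹. For n = 1 the dimension is therefore the index A² -
B².

The embedding follows Lefschetz. If θ is a section of L and n = k + 3, then θ(v+a) θ(v+b)
θ(v-kc-a-b) θ(v+c)ᵏ is a section of Lⁿ for all a, b, c. A generic choice makes it nonzero at a given
point. If all sections of Lⁿ take proportional values at w and w', varying a and b shows that every
θ(w + x) is θ(w' + x) times the exponential of an affine function of x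
(`theta_proportional_translates`). Comparison of Fourier coefficients then puts w - w' in the
lattice (`GaussianData.mem_lattice`). If a tangent vector v is not separated, the logarithmic
derivative of θ along v is affine (`theta_affine_logDeriv`), and its linear part agrees with πH_*(v,
·) on the lattice. One is linear and the other conjugate linear, so v = 0. Compactness of the torus
and the Hausdorff property of projective space turn the injective immersion into a closed embedding
(`sectionsEmbed_of_separates`). -/

namespace SpecialAbelianSurface

open Filter Topology

/-! ### Functional equations for entire functions. -/

section Entire

variable {E : Type*} [NormedAddCommGroup E] [NormedSpace ℂ E]

theorem analyticOnNhd_line {f : E → ℂ} (hf : Differentiable ℂ f) (x y : E) :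
    AnalyticOnNhd ℂ (fun t : ℂ => f (x + t • y)) Set.univ :=
  (Complex.analyticOnNhd_univ_iff_differentiable).2 (by fun_prop)

/-- The product of two nonzero entire functions is not zero. -/
theorem exists_mul_ne_zero {f g : E → ℂ} (hf : Differentiable ℂ f) (hg : Differentiable ℂ g)
    (hf0 : ∃ x, f x ≠ 0) (hg0 : ∃ x, g x ≠ 0) : ∃ x, f x * g x ≠ 0 := by
  obtain ⟨x, hx⟩ := hf0
  obtain ⟨y, hy⟩ := hg0
  by_contra! h
  -- On the complex line that passes through `x` at 0 and `y` at 1, this is the one-variable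
  -- statement.
  rcases AnalyticOnNhd.eq_zero_or_eq_zero_of_mul_eq_zero (analyticOnNhd_line hf x (y - x))
    (analyticOnNhd_line hg x (y - x)) (fun t _ => h _) isPreconnected_univ with h | h
  · exact hx (by simpa using h 0 trivial)
  · exact hy (by simpa using h 1 trivial)

/-- The identity theorem for entire functions. -/
theorem eq_zero_of_eventually_eq_zero {f : E → ℂ} (hf : Differentiable ℂ f) {a : E}
    (h : ∀ᶠ x in 𝓝 a, f x = 0) (x : E) : f x = 0 := by
  have hl := analyticOnNhd_line hf a (x - a)
  have ht : Tendsto (fun t : ℂ => a + t • (x - a)) (𝓝 0) (𝓝 a) := by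
    have : Continuous (fun t : ℂ => a + t • (x - a)) := by fun_prop
    simpa using this.tendsto 0
  have := hl.eqOn_zero_of_preconnected_of_eventuallyEq_zero isPreconnected_univ
    (Set.mem_univ 0) (ht.eventually h) (Set.mem_univ 1)
  simpa using this

/-- A function `ω` that is defined on the set where an entire function `u` does not vanish, and
that has equal values at points with a generic sum, is constant. -/
theorem eq_of_generic_reflection {X : Type*} {u : E → ℂ} (hu : Differentiable ℂ u) (s : E)
    {ω : E → X} (h : ∀ a b, u a ≠ 0 → u b ≠ 0 → u (s - a - b) ≠ 0 → ω a = ω (s - a - b))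
    {a a' : E} (ha : u a ≠ 0) (ha' : u a' ≠ 0) : ω a = ω a' := by
  have h1 : Differentiable ℂ (fun x => u (s - a - x)) := by fun_prop
  have h2 : Differentiable ℂ (fun x => u (s - a' - x)) := by fun_prop
  -- A common reflection partner: `u` is nonzero at `c`, `s - a - c` and `s - a' - c`, so `ω a` and
  -- `ω a'` both equal `ω c`.
  obtain ⟨c, hc⟩ := exists_mul_ne_zero hu
    (g := fun x => u (s - a - x) * u (s - a' - x)) (by fun_prop) ⟨a, ha⟩
    (exists_mul_ne_zero h1 h2 ⟨s - a - a, by simpa using ha⟩ ⟨s - a' - a, by simpa using ha⟩)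
  simp only [ne_eq, mul_eq_zero, not_or] at hc
  obtain ⟨hc, hc1, hc2⟩ := hc
  have e1 : s - a - (s - a - c) = c := by abel
  have e2 : s - a' - (s - a' - c) = c := by abel
  have k1 := h a (s - a - c) ha hc1 (by rwa [e1])
  have k2 := h a' (s - a' - c) ha' hc2 (by rwa [e2])
  rw [k1, k2, e1, e2]

/-- Two entire functions with equal logarithmic derivatives up to a constant differ by the
exponential of an affine function. -/
theorem eq_exp_mul_of_logDeriv {P Q : E → ℂ} (hP : Differentiable ℂ P) (hQ : Differentiable ℂ Q)
    {a₀ : E} (hP0 : P a₀ ≠ 0) (hQ0 : Q a₀ ≠ 0) (ℓ : E →L[ℂ] ℂ)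
    (h : ∀ a, P a ≠ 0 → Q a ≠ 0 → ∀ v,
      fderiv ℂ P a v / P a - fderiv ℂ Q a v / Q a = ℓ v) :
    ∃ C : ℂ, C ≠ 0 ∧ ∀ x, P x = C * Complex.exp (ℓ x) * Q x := by
  have hev : ∀ᶠ a in 𝓝 a₀, P a ≠ 0 ∧ Q a ≠ 0 :=
    (hP.continuous.continuousAt.eventually_ne hP0).and
      (hQ.continuous.continuousAt.eventually_ne hQ0)
  obtain ⟨r, hr, hball⟩ := Metric.eventually_nhds_iff_ball.1 hev
  -- On a ball where `P` and `Q` have no zeros `g` has derivative zero and is constant; the identity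
  -- theorem spreads the resulting equation to all of `E`.
  set g : E → ℂ := fun x => P x * (Q x)⁻¹ * Complex.exp (-ℓ x) with hg
  have hgd : ∀ x ∈ Metric.ball a₀ r, HasFDerivAt g (0 : E →L[ℂ] ℂ) x := by
    intro x hx
    obtain ⟨hPx, hQx⟩ := hball x hx
    have h1 := (((hP x).hasFDerivAt).mul
      ((hasDerivAt_inv hQx).comp_hasFDerivAt x (hQ x).hasFDerivAt)).mul
      ((ℓ.hasFDerivAt (x := x)).neg.cexp)
    refine h1.congr_fderiv ?_
    ext v
    have := h x hPx hQx v
    rw [div_sub_div _ _ hPx hQx, div_eq_iff (mul_ne_zero hPx hQx)] at this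
    simp
    field_simp
    linear_combination Complex.exp (-ℓ x) * this
  have hconst : ∀ x ∈ Metric.ball a₀ r, g x = g a₀ := by
    intro x hx
    refine Metric.isOpen_ball.is_const_of_fderiv_eq_zero (𝕜 := ℂ)
      ?_ (fun y hy => (hgd y hy).differentiableAt.differentiableWithinAt)
      (fun y hy => (hgd y hy).fderiv) hx (Metric.mem_ball_self hr)
    let _ : NormedSpace ℝ E := NormedSpace.restrictScalars ℝ ℂ E
    exact (convex_ball a₀ r).isPreconnected
  refine ⟨g a₀, mul_ne_zero (mul_ne_zero hP0 (inv_ne_zero hQ0)) (Complex.exp_ne_zero _),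
    fun x => ?_⟩
  have hd : Differentiable ℂ (fun x => P x - g a₀ * Complex.exp (ℓ x) * Q x) := by
    have := ℓ.differentiable
    fun_prop
  refine sub_eq_zero.1 (eq_zero_of_eventually_eq_zero hd (a := a₀) ?_ x)
  filter_upwards [Metric.ball_mem_nhds a₀ hr] with y hy
  obtain ⟨-, hQy⟩ := hball y hy
  rw [← hconst y hy, hg]
  simp only
  rw [Complex.exp_neg]
  field_simp [Complex.exp_ne_zero]
  ring

/-- A multiplicative functional equation for entire functions. -/
theorem eq_exp_mul_of_mul_eq {P Q : E → ℂ} (hP : Differentiable ℂ P) (hQ : Differentiable ℂ Q)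
    (hP0 : ∃ x, P x ≠ 0) (hQ0 : ∃ x, Q x ≠ 0) (s : E) (c : ℂ)
    (h : ∀ a b, P a * P b * P (s - a - b) = c * (Q a * Q b * Q (s - a - b))) :
    ∃ (ℓ : E →L[ℂ] ℂ) (C : ℂ), C ≠ 0 ∧ ∀ x, P x = C * Complex.exp (ℓ x) * Q x := by
  obtain ⟨a₀, ha₀⟩ := exists_mul_ne_zero hP hQ hP0 hQ0
  have hPQ : Differentiable ℂ (fun x => P x * Q x) := hP.mul hQ
  -- The difference of the logarithmic derivatives. Differentiating the equation in `a` with `b`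
  -- fixed moves the third argument by the opposite amount, so `ω a = ω (s - a - b)`.
  set ω : E → (E →L[ℂ] ℂ) := fun a => (P a)⁻¹ • fderiv ℂ P a - (Q a)⁻¹ • fderiv ℂ Q a with hω
  have key : ∀ a b, P a * Q a ≠ 0 → P b * Q b ≠ 0 → P (s - a - b) * Q (s - a - b) ≠ 0 →
      ω a = ω (s - a - b) := by
    intro a b ha hb hc
    have hs : HasFDerivAt (fun x => s - x - b) (-ContinuousLinearMap.id ℂ E) a := by
      simpa using ((hasFDerivAt_id a).const_sub s).sub_const b
    have d1 := (((hP a).hasFDerivAt).mul_const (P b)).mul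
      ((hP (s - a - b)).hasFDerivAt.comp a hs)
    have d2 := ((((hQ a).hasFDerivAt).mul_const (Q b)).mul
      ((hQ (s - a - b)).hasFDerivAt.comp a hs)).const_mul c
    have heq := d1.unique (d2.congr_of_eventuallyEq (Eventually.of_forall fun x => h x b))
    have hab := h a b
    simp only [ne_eq, mul_eq_zero, not_or] at ha hb hc
    obtain ⟨hPa, hQa⟩ := ha
    obtain ⟨hPb, hQb⟩ := hb
    obtain ⟨hPc, hQc⟩ := hc
    ext v
    have hv := DFunLike.congr_fun heq v
    simp at hv
    simp only [hω, sub_apply, smul_apply, smul_eq_mul]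
    have hc' : c = P a * P b * P (s - a - b) / (Q a * Q b * Q (s - a - b)) := by
      rw [eq_div_iff (by simp [*]), hab]
    rw [hc'] at hv
    field_simp at hv ⊢
    linear_combination hv
  obtain ⟨hP0, hQ0⟩ := mul_ne_zero_iff.1 ha₀
  obtain ⟨C, hC, hx⟩ := eq_exp_mul_of_logDeriv hP hQ hP0 hQ0 (ω a₀) (fun a hPa hQa v => by
    rw [← eq_of_generic_reflection hPQ s key (mul_ne_zero hPa hQa) ha₀]
    simp [hω]
    ring)
  exact ⟨_, C, hC, hx⟩

/-- An additive functional equation for a quotient of entire functions. -/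
theorem eq_affine_mul_of_add_eq {P P' : E → ℂ} (hP : Differentiable ℂ P)
    (hP' : Differentiable ℂ P') (hP0 : ∃ x, P x ≠ 0) (s : E) (c : ℂ)
    (h : ∀ a b, P' a * P b * P (s - a - b) + P a * P' b * P (s - a - b) +
      P a * P b * P' (s - a - b) = c * (P a * P b * P (s - a - b))) :
    ∃ (ℓ : E →L[ℂ] ℂ) (d : ℂ), ∀ x, P' x = (ℓ x + d) * P x := by
  obtain ⟨a₀, ha₀⟩ := hP0
  -- After division the equation reads `R a + R b + R (s - a - b) = c`. Differentiation in `a` shows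
  -- that the derivative of `R` is constant, so `R` is affine.
  set R : E → ℂ := fun x => P' x * (P x)⁻¹ with hR
  have hRd : ∀ x, P x ≠ 0 → DifferentiableAt ℂ R x := fun x hx =>
    (hP' x).mul ((hP x).inv hx)
  have key : ∀ a b, P a ≠ 0 → P b ≠ 0 → P (s - a - b) ≠ 0 →
      fderiv ℂ R a = fderiv ℂ R (s - a - b) := by
    intro a b ha hb hc
    have hs : HasFDerivAt (fun x => s - x - b) (-ContinuousLinearMap.id ℂ E) a := by
      simpa using ((hasFDerivAt_id a).const_sub s).sub_const b
    have d1 := (hRd a ha).hasFDerivAt.add ((hRd _ hc).hasFDerivAt.comp a hs)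
    have d2 := hasFDerivAt_const (𝕜 := ℂ) (c - R b) a
    have hcont : Continuous (fun x => P (s - x - b)) :=
      hP.continuous.comp (by fun_prop)
    have heq := d1.unique (d2.congr_of_eventuallyEq (by
      filter_upwards [hP.continuous.continuousAt.eventually_ne ha,
        hcont.continuousAt.eventually_ne hc] with x hx hxc
      have := h x b
      simp only [hR, Pi.add_apply, Function.comp_apply]
      field_simp
      linear_combination this))
    ext v
    have hv := DFunLike.congr_fun heq v
    simp at hv
    linear_combination hv
  set ℓ := fderiv ℂ R a₀ with hℓ
  have hev := hP.continuous.continuousAt.eventually_ne ha₀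
  obtain ⟨r, hr, hball⟩ := Metric.eventually_nhds_iff_ball.1 hev
  have hgd : ∀ x ∈ Metric.ball a₀ r, HasFDerivAt (fun x => R x - ℓ x) (0 : E →L[ℂ] ℂ) x := by
    intro x hx
    have h1 := (hRd x (hball x hx)).hasFDerivAt.sub (ℓ.hasFDerivAt (x := x))
    rwa [eq_of_generic_reflection hP s key (hball x hx) ha₀, sub_self] at h1
  have hconst : ∀ x ∈ Metric.ball a₀ r, R x - ℓ x = R a₀ - ℓ a₀ := by
    intro x hx
    refine Metric.isOpen_ball.is_const_of_fderiv_eq_zero (𝕜 := ℂ)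
      ?_ (fun y hy => (hgd y hy).differentiableAt.differentiableWithinAt)
      (fun y hy => (hgd y hy).fderiv) hx (Metric.mem_ball_self hr)
    let _ : NormedSpace ℝ E := NormedSpace.restrictScalars ℝ ℂ E
    exact (convex_ball a₀ r).isPreconnected
  refine ⟨ℓ, R a₀ - ℓ a₀, fun x => ?_⟩
  have hd : Differentiable ℂ (fun x => P' x - (ℓ x + (R a₀ - ℓ a₀)) * P x) := by
    have := ℓ.differentiable
    fun_prop
  refine sub_eq_zero.1 (eq_zero_of_eventually_eq_zero hd (a := a₀) ?_ x)
  filter_upwards [Metric.ball_mem_nhds a₀ hr] with y hy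
  have hy0 := hball y hy
  rw [← hconst y hy, hR]
  field_simp
  ring

end Entire

end SpecialAbelianSurface

namespace SpecialAbelianSurface

open Filter Topology Complex

section Fourier

/-! ### Fourier coefficients of periodic entire functions -/

/-- The real part of `w` is absorbed by periodicity. For the imaginary part Cauchy's theorem is
applied to a rectangle of width 1, whose vertical sides cancel by periodicity. -/
theorem intervalIntegral_shift {g : ℂ → ℂ} (hg : Differentiable ℂ g)
    (hp : Function.Periodic g 1) (w : ℂ) :
    ∫ x in (0 : ℝ)..1, g (x + w) = ∫ x in (0 : ℝ)..1, g x := by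
  have h1 : ∫ x in (0 : ℝ)..1, g (x + w) = ∫ x in (0 : ℝ)..1, g (x + w.im * I) := by
    have hper : Function.Periodic (fun x : ℝ => g (x + w.im * I)) 1 := by
      intro x
      have := hp (x + w.im * I)
      simpa [add_right_comm] using this
    have h := hper.intervalIntegral_add_eq w.re 0
    rw [zero_add] at h
    rw [← h]
    have h2 := intervalIntegral.integral_comp_add_right (a := (0 : ℝ)) (b := 1)
      (fun x : ℝ => g (x + w.im * I)) w.re
    rw [zero_add, add_comm 1 w.re] at h2
    rw [← h2]
    congr 1
    ext x
    congr 1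
    push_cast
    rw [add_assoc, re_add_im]
  rw [h1]
  have h := integral_boundary_rect_eq_zero_of_differentiableOn g 0 (1 + w.im * I)
    hg.differentiableOn
  have h3 : ∫ y in (0 : ℝ)..w.im, g (1 + y * I) = ∫ y in (0 : ℝ)..w.im, g (y * I) := by
    congr 1
    ext y
    rw [add_comm, hp]
  simp [h3] at h
  linear_combination -h

/-- Vanishing coefficients are summable, so the Fourier series converges pointwise to `f`. -/
theorem eq_zero_of_fourier_integrals_eq_zero {f : ℝ → ℂ} (hf : Continuous f)
    (hp : Function.Periodic f 1)
    (h : ∀ n : ℤ, ∫ x in (0 : ℝ)..1, exp (2 * Real.pi * I * n * x) * f x = 0) (x : ℝ) :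
    f x = 0 := by
  have hc : Continuous (hp.lift : AddCircle (1 : ℝ) → ℂ) := continuous_coinduced_dom.mpr hf
  have hz : ∀ n, fourierCoeff (hp.lift : AddCircle (1 : ℝ) → ℂ) n = 0 := by
    intro n
    rw [fourierCoeff_eq_intervalIntegral _ _ 0, zero_add]
    have : ∀ x : ℝ, fourier (T := (1 : ℝ)) (-n) x • hp.lift (x : AddCircle (1 : ℝ)) =
        exp (2 * Real.pi * I * ((-n : ℤ) : ℂ) * x) * f x := by
      intro x
      rw [fourier_coe_apply, Function.Periodic.lift_coe, smul_eq_mul]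
      simp
    simp_rw [this]
    rw [h, smul_zero]
  have hs := has_pointwise_sum_fourier_series_of_summable (f := ⟨_, hc⟩)
    (by simp [funext hz]) (x : AddCircle (1 : ℝ))
  simp only [ContinuousMap.coe_mk, hz, zero_smul] at hs
  exact hs.unique hasSum_zero

/-- The character `v ↦ exp(2πi (k₁ v₁ + k₂ v₂))`. -/
noncomputable def expChar (k : ℤ × ℤ) (v : Fin 2 → ℂ) : ℂ :=
  exp (2 * Real.pi * I * (k.1 * v 0 + k.2 * v 1))

theorem expChar_zero (v : Fin 2 → ℂ) : expChar 0 v = 1 := by simp [expChar]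

theorem expChar_add (k l : ℤ × ℤ) (v : Fin 2 → ℂ) :
    expChar (k + l) v = expChar k v * expChar l v := by
  rw [expChar, expChar, expChar, ← exp_add]
  congr 1
  simp
  ring

theorem expChar_add_right (k : ℤ × ℤ) (v w : Fin 2 → ℂ) :
    expChar k (v + w) = expChar k v * expChar k w := by
  rw [expChar, expChar, expChar, ← exp_add]
  congr 1
  simp
  ring

theorem expChar_neg_mul (k : ℤ × ℤ) (v : Fin 2 → ℂ) : expChar (-k) v * expChar k v = 1 := by
  rw [← expChar_add, neg_add_cancel, expChar_zero]

theorem expChar_int (k : ℤ × ℤ) (m n : ℤ) : expChar k ![(m : ℂ), (n : ℂ)] = 1 := by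
  rw [expChar, exp_eq_one_iff]
  refine ⟨k.1 * m + k.2 * n, ?_⟩
  simp
  ring

theorem expChar_e0 (k : ℤ × ℤ) : expChar k ![1, 0] = 1 := by
  simpa using expChar_int k 1 0

theorem expChar_e1 (k : ℤ × ℤ) : expChar k ![0, 1] = 1 := by
  simpa using expChar_int k 0 1

theorem differentiable_expChar (k : ℤ × ℤ) : Differentiable ℂ (expChar k) := by
  unfold expChar
  fun_prop

theorem norm_expChar_real (k : ℤ × ℤ) (x y : ℝ) : ‖expChar k ![(x : ℂ), (y : ℂ)]‖ = 1 := by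
  rw [expChar, norm_exp]
  simp

/-- Functions on `ℂ²` with periods `(1, 0)` and `(0, 1)`. -/
def IsPeriodic (f : (Fin 2 → ℂ) → ℂ) : Prop :=
  (∀ v, f (v + ![1, 0]) = f v) ∧ ∀ v, f (v + ![0, 1]) = f v

theorem IsPeriodic.mul {f g : (Fin 2 → ℂ) → ℂ} (hf : IsPeriodic f) (hg : IsPeriodic g) :
    IsPeriodic (fun v => f v * g v) :=
  ⟨fun v => by simp only [hf.1 v, hg.1 v], fun v => by simp only [hf.2 v, hg.2 v]⟩

theorem isPeriodic_expChar (k : ℤ × ℤ) : IsPeriodic (expChar k) :=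
  ⟨fun v => by rw [expChar_add_right, expChar_e0, mul_one],
    fun v => by rw [expChar_add_right, expChar_e1, mul_one]⟩

/-- The mean value of a periodic function over a real period square. -/
noncomputable def mean (f : (Fin 2 → ℂ) → ℂ) : ℂ :=
  ∫ x in (0 : ℝ)..1, ∫ y in (0 : ℝ)..1, f ![(x : ℂ), (y : ℂ)]

theorem intervalIntegral_swap_of_continuous {F : ℝ → ℝ → ℂ} (hF : Continuous F.uncurry) :
    ∫ x in (0 : ℝ)..1, ∫ y in (0 : ℝ)..1, F x y = ∫ y in (0 : ℝ)..1, ∫ x in (0 : ℝ)..1, F x y := by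
  refine MeasureTheory.intervalIntegral_intervalIntegral_swap ?_
  refine (hF.continuousOn.integrableOn_compact (K := Set.Icc 0 1 ×ˢ Set.Icc 0 1)
    (isCompact_Icc.prod isCompact_Icc)).mono_set ?_
  rw [Set.uIoc_of_le zero_le_one]
  exact Set.prod_mono Set.Ioc_subset_Icc_self Set.Ioc_subset_Icc_self

theorem continuous_vec_real : Continuous (fun p : ℝ × ℝ => (![(p.1 : ℂ), (p.2 : ℂ)] : Fin 2 → ℂ)) := by
  refine continuous_pi fun i => ?_
  fin_cases i <;> simp <;> fun_prop

theorem differentiable_vec_left (y : ℂ) : Differentiable ℂ (fun t : ℂ => (![t, y] : Fin 2 → ℂ)) := by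
  refine differentiable_pi.2 fun i => ?_
  fin_cases i <;> simp

theorem differentiable_vec_right (x : ℂ) : Differentiable ℂ (fun t : ℂ => (![x, t] : Fin 2 → ℂ)) := by
  refine differentiable_pi.2 fun i => ?_
  fin_cases i <;> simp

theorem IsPeriodic.left {f : (Fin 2 → ℂ) → ℂ} (hf : IsPeriodic f) (y : ℂ) :
    Function.Periodic (fun t : ℂ => f ![t, y]) 1 := fun t => by
  simpa using hf.1 ![t, y]

theorem IsPeriodic.right {f : (Fin 2 → ℂ) → ℂ} (hf : IsPeriodic f) (x : ℂ) :
    Function.Periodic (fun t : ℂ => f ![x, t]) 1 := fun t => by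
  simpa using hf.2 ![x, t]

theorem mean_shift {f : (Fin 2 → ℂ) → ℂ} (hf : Differentiable ℂ f) (hp : IsPeriodic f)
    (w : Fin 2 → ℂ) : mean (fun v => f (v + w)) = mean f := by
  have e : ∀ x y : ℝ, (![(x : ℂ), (y : ℂ)] + w : Fin 2 → ℂ) = ![x + w 0, y + w 1] := by
    intro x y
    ext i
    fin_cases i <;> simp
  unfold mean
  simp_rw [e]
  have h1 : ∀ x : ℝ, ∫ y in (0 : ℝ)..1, f ![x + w 0, y + w 1] =
      ∫ y in (0 : ℝ)..1, f ![x + w 0, y] := fun x =>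
    intervalIntegral_shift (hf.comp (differentiable_vec_right _)) (hp.right _) _
  have h2 : ∀ y : ℝ, ∫ x in (0 : ℝ)..1, f ![x + w 0, y] = ∫ x in (0 : ℝ)..1, f ![(x : ℂ), y] :=
    fun y => intervalIntegral_shift (hf.comp (differentiable_vec_left _)) (hp.left _) _
  simp_rw [h1]
  have hc : Continuous (fun p : ℝ × ℝ => (![(p.1 : ℂ) + w 0, (p.2 : ℂ)] : Fin 2 → ℂ)) := by
    refine continuous_pi fun i => ?_
    fin_cases i <;> simp <;> fun_prop
  -- The order of integration is exchanged so that the shift of the first variable also falls on an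
  -- inner integral.
  rw [intervalIntegral_swap_of_continuous (F := fun x y : ℝ => f ![x + w 0, y])
    (hf.continuous.comp hc), intervalIntegral_swap_of_continuous
    (F := fun x y : ℝ => f ![(x : ℂ), y]) (hf.continuous.comp continuous_vec_real)]
  simp_rw [h2]

/-- The Fourier coefficients of a periodic function. -/
noncomputable def fcoeff (f : (Fin 2 → ℂ) → ℂ) (k : ℤ × ℤ) : ℂ :=
  mean (fun v => f v * expChar (-k) v)

theorem mean_const_mul (c : ℂ) (f : (Fin 2 → ℂ) → ℂ) : mean (fun v => c * f v) = c * mean f := by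
  simp [mean, intervalIntegral.integral_const_mul]

theorem fcoeff_const_mul (c : ℂ) (f : (Fin 2 → ℂ) → ℂ) (k : ℤ × ℤ) :
    fcoeff (fun v => c * f v) k = c * fcoeff f k := by
  simp [fcoeff, mul_assoc, mean_const_mul]

theorem fcoeff_sub {f g : (Fin 2 → ℂ) → ℂ} (hf : Differentiable ℂ f) (hg : Differentiable ℂ g)
    (k : ℤ × ℤ) : fcoeff (fun v => f v - g v) k = fcoeff f k - fcoeff g k := by
  have hc : ∀ h : (Fin 2 → ℂ) → ℂ, Differentiable ℂ h → Continuous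
      (fun p : ℝ × ℝ => h ![(p.1 : ℂ), (p.2 : ℂ)] * expChar (-k) ![(p.1 : ℂ), (p.2 : ℂ)]) :=
    fun h hh => (hh.mul (differentiable_expChar _)).continuous.comp continuous_vec_real
  simp only [fcoeff, mean, sub_mul]
  rw [← intervalIntegral.integral_sub]
  · congr 1
    ext x
    rw [intervalIntegral.integral_sub]
    · exact ((hc f hf).comp (by fun_prop : Continuous fun y : ℝ => (x, y))).intervalIntegrable _ _
    · exact ((hc g hg).comp (by fun_prop : Continuous fun y : ℝ => (x, y))).intervalIntegrable _ _
  · exact (intervalIntegral.continuous_parametric_intervalIntegral_of_continuous'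
      (hc f hf) 0 1).intervalIntegrable _ _
  · exact (intervalIntegral.continuous_parametric_intervalIntegral_of_continuous'
      (hc g hg) 0 1).intervalIntegrable _ _

/-- Since the mean is invariant under complex translations, these act diagonally on Fourier
coefficients. This turns functional equations into recursions. -/
theorem fcoeff_shift {f : (Fin 2 → ℂ) → ℂ} (hf : Differentiable ℂ f) (hp : IsPeriodic f)
    (w : Fin 2 → ℂ) (k : ℤ × ℤ) :
    fcoeff (fun v => f (v + w)) k = expChar k w * fcoeff f k := by
  have h := mean_shift (hf.mul (differentiable_expChar (-k))) (hp.mul (isPeriodic_expChar _)) w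
  have : (fun v => f (v + w) * expChar (-k) v) =
      fun v => expChar k w * ((f * expChar (-k)) (v + w)) := by
    ext v
    rw [Pi.mul_apply, expChar_add_right]
    linear_combination (-f (v + w) * expChar (-k) v) * expChar_neg_mul k w
  rw [fcoeff, this, mean_const_mul, h]
  rfl

theorem fcoeff_mul_expChar (f : (Fin 2 → ℂ) → ℂ) (p k : ℤ × ℤ) :
    fcoeff (fun v => expChar p v * f v) k = fcoeff f (k - p) := by
  unfold fcoeff
  congr 1
  ext v
  rw [show -(k - p) = p + -k by abel, expChar_add]
  ring

theorem eq_zero_of_eq_zero_on_real {g : ℂ → ℂ} (hg : Differentiable ℂ g)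
    (h : ∀ x : ℝ, g x = 0) (z : ℂ) : g z = 0 := by
  have ha : AnalyticOnNhd ℂ g Set.univ := analyticOnNhd_univ_iff_differentiable.2 hg
  have hfr : ∃ᶠ z in 𝓝[≠] (0 : ℂ), g z = 0 := by
    have ht : Tendsto (fun n : ℕ => (((1 / ((n : ℝ) + 1) : ℝ)) : ℂ)) atTop (𝓝[≠] 0) := by
      refine tendsto_nhdsWithin_iff.2 ⟨?_, Eventually.of_forall fun n => ?_⟩
      · have := (continuous_ofReal.tendsto 0).comp
          (tendsto_one_div_add_atTop_nhds_zero_nat (𝕜 := ℝ))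
        simpa [Function.comp_def] using this
      · simp only [Set.mem_compl_iff, Set.mem_singleton_iff, ofReal_eq_zero]
        positivity
    exact ht.frequently (Frequently.of_forall fun n => h _)
  exact ha.eqOn_zero_of_preconnected_of_frequently_eq_zero isPreconnected_univ
    (Set.mem_univ 0) hfr (Set.mem_univ z)

/-- A periodic entire function is determined by its Fourier coefficients. -/
theorem eq_zero_of_fcoeff_eq_zero {f : (Fin 2 → ℂ) → ℂ} (hf : Differentiable ℂ f)
    (hp : IsPeriodic f) (h : ∀ k, fcoeff f k = 0) (v : Fin 2 → ℂ) : f v = 0 := by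
  have hreal : ∀ x y : ℝ, f ![(x : ℂ), (y : ℂ)] = 0 := by
    intro x y
    refine eq_zero_of_fourier_integrals_eq_zero (f := fun y : ℝ => f ![(x : ℂ), (y : ℂ)])
      (hf.continuous.comp (continuous_vec_real.comp (by fun_prop : Continuous fun y : ℝ => (x, y))))
      (fun y => by simpa using hp.right x y) (fun n => ?_) y
    have hc : Continuous (fun p : ℝ × ℝ => exp (2 * Real.pi * I * n * p.2) *
        f ![(p.1 : ℂ), (p.2 : ℂ)]) :=
      Continuous.mul (by fun_prop) (hf.continuous.comp continuous_vec_real)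
    -- The `n`-th Fourier integral in `y` is itself a periodic function of `x`, and its Fourier
    -- integrals are the double coefficients.
    refine eq_zero_of_fourier_integrals_eq_zero
      (f := fun x : ℝ => ∫ y in (0 : ℝ)..1, exp (2 * Real.pi * I * n * y) * f ![(x : ℂ), (y : ℂ)])
      (intervalIntegral.continuous_parametric_intervalIntegral_of_continuous' hc 0 1)
      (fun x => ?_) (fun m => ?_) x
    · refine intervalIntegral.integral_congr fun y _ => ?_
      have := hp.left y x
      simp only at this
      simp only [ofReal_add, ofReal_one, this]
    · rw [← h (-m, -n), fcoeff, mean]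
      congr 1
      ext x
      rw [← intervalIntegral.integral_const_mul]
      congr 1
      ext y
      have : expChar (-(-m, -n)) ![(x : ℂ), (y : ℂ)] =
          exp (2 * Real.pi * I * m * x) * exp (2 * Real.pi * I * n * y) := by
        rw [expChar, ← exp_add]
        congr 1
        simp
        ring
      rw [this]
      ring
  have h1 : ∀ (x : ℝ) (t : ℂ), f ![(x : ℂ), t] = 0 := fun x t =>
    eq_zero_of_eq_zero_on_real (hf.comp (differentiable_vec_right x)) (hreal x) t
  have h2 : ∀ s t : ℂ, f ![s, t] = 0 := fun s t =>
    eq_zero_of_eq_zero_on_real (hf.comp (differentiable_vec_left t)) (fun x => h1 x t) s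
  rw [← h2 (v 0) (v 1)]
  congr 1
  ext i
  fin_cases i <;> rfl

theorem intervalIntegral_exp_int (n : ℤ) :
    ∫ x in (0 : ℝ)..1, exp (2 * Real.pi * I * n * x) = if n = 0 then 1 else 0 := by
  split_ifs with h
  · simp [h]
  · rw [integral_exp_mul_complex (by simp [Real.pi_ne_zero, h])]
    have : exp (2 * Real.pi * I * n * ((1 : ℝ) : ℂ)) = 1 :=
      exp_eq_one_iff.2 ⟨n, by push_cast; ring⟩
    rw [this]
    simp

theorem mean_expChar (k : ℤ × ℤ) : mean (expChar k) = if k = 0 then 1 else 0 := by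
  have : ∀ x y : ℝ, expChar k ![(x : ℂ), (y : ℂ)] =
      exp (2 * Real.pi * I * k.1 * x) * exp (2 * Real.pi * I * k.2 * y) := by
    intro x y
    rw [expChar, ← exp_add]
    congr 1
    simp
    ring
  simp_rw [mean, this, intervalIntegral.integral_const_mul, intervalIntegral.integral_mul_const,
    intervalIntegral_exp_int]
  rcases k with ⟨m, n⟩
  by_cases hm : m = 0 <;> by_cases hn : n = 0 <;> simp [hm, hn]

/-- The Fourier coefficients of an absolutely convergent Fourier series. -/
theorem fcoeff_of_hasSum {f : (Fin 2 → ℂ) → ℂ} {c : ℤ × ℤ → ℂ} (hc : Summable fun k => ‖c k‖)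
    (h : ∀ v, HasSum (fun k => c k * expChar k v) (f v)) (k : ℤ × ℤ) : fcoeff f k = c k := by
  have hterm : ∀ l v, c l * expChar l v * expChar (-k) v = c l * expChar (l - k) v := by
    intro l v
    rw [sub_eq_add_neg, expChar_add]
    ring
  have hcont : ∀ l, Continuous (fun p : ℝ × ℝ => c l * expChar (l - k) ![(p.1 : ℂ), (p.2 : ℂ)]) :=
    fun l => continuous_const.mul
      ((differentiable_expChar _).continuous.comp continuous_vec_real)
  have hin : ∀ x : ℝ, HasSum
      (fun l => ∫ y in (0 : ℝ)..1, c l * expChar (l - k) ![(x : ℂ), (y : ℂ)])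
      (∫ y in (0 : ℝ)..1, f ![(x : ℂ), (y : ℂ)] * expChar (-k) ![(x : ℂ), (y : ℂ)]) := by
    intro x
    refine intervalIntegral.hasSum_integral_of_dominated_convergence (fun l _ => ‖c l‖)
      (fun l => ?_) (fun l => ?_) ?_ ?_ ?_
    · exact ((hcont l).comp (by fun_prop : Continuous fun y : ℝ => (x, y))).aestronglyMeasurable
    · exact Eventually.of_forall fun y _ => by rw [norm_mul, norm_expChar_real, mul_one]
    · exact Eventually.of_forall fun y _ => hc
    · exact intervalIntegrable_const
    · refine Eventually.of_forall fun y _ => ?_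
      simpa only [hterm] using (h ![(x : ℂ), (y : ℂ)]).mul_right (expChar (-k) ![(x : ℂ), (y : ℂ)])
  have hout : HasSum (fun l => mean (fun v => c l * expChar (l - k) v)) (fcoeff f k) := by
    refine intervalIntegral.hasSum_integral_of_dominated_convergence (fun l _ => ‖c l‖)
      (fun l => ?_) (fun l => ?_) ?_ ?_ ?_
    · exact (intervalIntegral.continuous_parametric_intervalIntegral_of_continuous'
        (hcont l) 0 1).aestronglyMeasurable
    · refine Eventually.of_forall fun x _ => ?_
      refine (intervalIntegral.norm_integral_le_of_norm_le_const (C := ‖c l‖) fun y _ => ?_).trans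
        (by simp)
      rw [norm_mul, norm_expChar_real, mul_one]
    · exact Eventually.of_forall fun y _ => hc
    · exact intervalIntegrable_const
    · exact Eventually.of_forall fun x _ => hin x
  refine hout.unique ?_
  convert hasSum_ite_eq k (c k) using 2 with l
  rw [mean_const_mul, mean_expChar]
  by_cases hl : l = k
  · simp [hl]
  · simp [hl, sub_eq_zero]

end Fourier

end SpecialAbelianSurface

namespace SpecialAbelianSurface

open Filter Topology Complex

section Series

/-! ### Rapidly convergent Fourier series -/

/-- The size of an index. -/
def l1norm (k : ℤ × ℤ) : ℝ := |(k.1 : ℝ)| + |(k.2 : ℝ)|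

theorem l1norm_nonneg (k : ℤ × ℤ) : 0 ≤ l1norm k := by unfold l1norm; positivity

/-- Coefficients of Fourier series that converge on all of `ℂ²`. -/
def RapidDecay (c : ℤ × ℤ → ℂ) : Prop :=
  ∀ R : ℝ, Summable fun k => ‖c k‖ * Real.exp (R * l1norm k)

/-- The sum of a Fourier series. -/
noncomputable def fourierSeries (c : ℤ × ℤ → ℂ) (v : Fin 2 → ℂ) : ℂ := ∑' k, c k * expChar k v

theorem RapidDecay.mul_of_le {c : ℤ × ℤ → ℂ} (hc : RapidDecay c) {g : ℤ × ℤ → ℂ} {C D : ℝ}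
    (hg : ∀ k, ‖g k‖ ≤ C * Real.exp (D * l1norm k)) : RapidDecay (fun k => g k * c k) := by
  intro R
  refine ((hc (D + R)).mul_left C).of_nonneg_of_le (fun k => by positivity) fun k => ?_
  rw [norm_mul, add_mul, Real.exp_add]
  calc ‖g k‖ * ‖c k‖ * Real.exp (R * l1norm k)
      ≤ (C * Real.exp (D * l1norm k)) * ‖c k‖ * Real.exp (R * l1norm k) := by gcongr; exact hg k
    _ = _ := by ring

theorem RapidDecay.mul_bounded {c : ℤ × ℤ → ℂ} (hc : RapidDecay c) {g : ℤ × ℤ → ℂ} {C : ℝ}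
    (hg : ∀ k, ‖g k‖ ≤ C) : RapidDecay (fun k => g k * c k) :=
  hc.mul_of_le (C := C) (D := 0) (by simpa using hg)

theorem norm_pairing_le (k : ℤ × ℤ) (v : Fin 2 → ℂ) :
    ‖(k.1 * v 0 + k.2 * v 1 : ℂ)‖ ≤ ‖v‖ * l1norm k := by
  calc ‖(k.1 * v 0 + k.2 * v 1 : ℂ)‖ ≤ |(k.1 : ℝ)| * ‖v 0‖ + |(k.2 : ℝ)| * ‖v 1‖ := by
        refine (norm_add_le _ _).trans (le_of_eq ?_)
        simp
    _ ≤ |(k.1 : ℝ)| * ‖v‖ + |(k.2 : ℝ)| * ‖v‖ := by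
        gcongr <;> exact norm_le_pi_norm v _
    _ = _ := by unfold l1norm; ring

theorem norm_expChar_le (k : ℤ × ℤ) (v : Fin 2 → ℂ) :
    ‖expChar k v‖ ≤ Real.exp (2 * Real.pi * ‖v‖ * l1norm k) := by
  refine (norm_exp_le_exp_norm _).trans (Real.exp_le_exp.2 ?_)
  rw [norm_mul, mul_assoc (2 * Real.pi)]
  have : ‖(2 * Real.pi * I : ℂ)‖ = 2 * Real.pi := by
    simp [Real.pi_pos.le]
  rw [this]
  gcongr
  exact norm_pairing_le k v

theorem RapidDecay.summable {c : ℤ × ℤ → ℂ} (hc : RapidDecay c) : Summable fun k => ‖c k‖ := by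
  simpa using hc 0

theorem RapidDecay.hasSum {c : ℤ × ℤ → ℂ} (hc : RapidDecay c) (v : Fin 2 → ℂ) :
    HasSum (fun k => c k * expChar k v) (fourierSeries c v) := by
  refine Summable.hasSum ((hc (2 * Real.pi * ‖v‖)).of_norm_bounded fun k => ?_)
  rw [norm_mul]
  gcongr
  exact norm_expChar_le k v

theorem isPeriodic_fourierSeries (c : ℤ × ℤ → ℂ) : IsPeriodic (fourierSeries c) :=
  ⟨fun v => by simp only [fourierSeries, (isPeriodic_expChar _).1],
    fun v => by simp only [fourierSeries, (isPeriodic_expChar _).2]⟩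

theorem RapidDecay.fcoeff_fourierSeries {c : ℤ × ℤ → ℂ} (hc : RapidDecay c) (k : ℤ × ℤ) :
    fcoeff (fourierSeries c) k = c k :=
  fcoeff_of_hasSum hc.summable hc.hasSum k

/-- These are the coefficients of the derivative in the direction `v`. -/
theorem RapidDecay.mul_pairing {c : ℤ × ℤ → ℂ} (hc : RapidDecay c) (v : Fin 2 → ℂ) :
    RapidDecay (fun k => 2 * Real.pi * I * (k.1 * v 0 + k.2 * v 1) * c k) := by
  refine hc.mul_of_le (C := 2 * Real.pi * ‖v‖) (D := 1) fun k => ?_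
  have : ‖(2 * Real.pi * I : ℂ)‖ = 2 * Real.pi := by
    simp [Real.pi_pos.le]
  rw [norm_mul, this, mul_assoc (2 * Real.pi)]
  refine mul_le_mul_of_nonneg_left ((norm_pairing_le k v).trans ?_) (by positivity)
  gcongr
  rw [one_mul]
  linarith [Real.add_one_le_exp (l1norm k)]

/-- The differential of the pairing of an index with a vector. -/
noncomputable def pairingCLM (k : ℤ × ℤ) : (Fin 2 → ℂ) →L[ℂ] ℂ :=
  (k.1 : ℂ) • ContinuousLinearMap.proj 0 + (k.2 : ℂ) • ContinuousLinearMap.proj 1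

theorem pairingCLM_apply (k : ℤ × ℤ) (v : Fin 2 → ℂ) :
    pairingCLM k v = k.1 * v 0 + k.2 * v 1 := by
  simp [pairingCLM]

theorem norm_pairingCLM_le (k : ℤ × ℤ) : ‖pairingCLM k‖ ≤ l1norm k :=
  ContinuousLinearMap.opNorm_le_bound _ (l1norm_nonneg k) fun v => by
    rw [pairingCLM_apply, mul_comm (l1norm k)]
    exact norm_pairing_le k v

theorem hasFDerivAt_expChar (k : ℤ × ℤ) (x : Fin 2 → ℂ) :
    HasFDerivAt (expChar k) ((expChar k x * (2 * Real.pi * I)) • pairingCLM k) x := by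
  have h := (((pairingCLM k).hasFDerivAt (x := x)).const_mul (2 * Real.pi * I)).cexp
  rw [smul_smul] at h
  have e : (fun v => exp (2 * Real.pi * I * pairingCLM k v)) = expChar k := by
    ext v
    rw [pairingCLM_apply, expChar]
  rw [e] at h
  rw [← e]
  simpa only [e] using h

theorem RapidDecay.hasFDerivAt {c : ℤ × ℤ → ℂ} (hc : RapidDecay c) (x : Fin 2 → ℂ) :
    ∃ f' : (Fin 2 → ℂ) →L[ℂ] ℂ, HasFDerivAt (fourierSeries c) f' x ∧
      ∀ v, f' v = fourierSeries (fun k => 2 * Real.pi * I * (k.1 * v 0 + k.2 * v 1) * c k) x := by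
  set f' : ℤ × ℤ → (Fin 2 → ℂ) → ((Fin 2 → ℂ) →L[ℂ] ℂ) :=
    fun k y => c k • ((expChar k y * (2 * Real.pi * I)) • pairingCLM k) with hf'
  set r := ‖x‖ + 1
  -- The factor `‖pairingCLM k‖ ≤ l1norm k` is bounded by `exp (l1norm k)`, whence the `+ 1` in the
  -- exponent.
  set u : ℤ × ℤ → ℝ := fun k =>
    2 * Real.pi * (‖c k‖ * Real.exp ((2 * Real.pi * r + 1) * l1norm k)) with hu
  have hus : Summable u := (hc _).mul_left _
  have hx : x ∈ Metric.ball (0 : Fin 2 → ℂ) r := by simp [r]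
  have hbound : ∀ k y, y ∈ Metric.ball (0 : Fin 2 → ℂ) r → ‖f' k y‖ ≤ u k := by
    intro k y hy
    have hy : ‖y‖ ≤ r := by simpa using (mem_ball_zero_iff.1 hy).le
    have h2 : ‖(2 * Real.pi * I : ℂ)‖ = 2 * Real.pi := by
      simp [Real.pi_pos.le]
    rw [hf', norm_smul, norm_smul, norm_mul, h2, hu]
    calc ‖c k‖ * (‖expChar k y‖ * (2 * Real.pi) * ‖pairingCLM k‖)
        ≤ ‖c k‖ * (Real.exp (2 * Real.pi * r * l1norm k) * (2 * Real.pi) *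
          Real.exp (l1norm k)) := by
          gcongr
          · refine (norm_expChar_le k y).trans ?_
            have := l1norm_nonneg k
            gcongr
          · refine (norm_pairingCLM_le k).trans ?_
            linarith [Real.add_one_le_exp (l1norm k)]
      _ = _ := by
          simp only [add_mul, one_mul, Real.exp_add]
          ring
  have hpre : IsPreconnected (Metric.ball (0 : Fin 2 → ℂ) r) :=
    (convex_ball (0 : Fin 2 → ℂ) r).isPreconnected
  have hd : ∀ k y, y ∈ Metric.ball (0 : Fin 2 → ℂ) r →
      HasFDerivAt (fun v => c k * expChar k v) (f' k y) y := fun k y _ =>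
    (hasFDerivAt_expChar k y).const_mul (c k)
  have h := hasFDerivAt_tsum_of_isPreconnected hus Metric.isOpen_ball hpre hd hbound hx
    (hc.hasSum x).summable hx
  refine ⟨_, h, fun v => ?_⟩
  have hsum : Summable fun k => f' k x := hus.of_norm_bounded fun k => hbound k x hx
  have := (ContinuousLinearMap.apply ℂ ℂ v).map_tsum hsum
  simp only [ContinuousLinearMap.apply_apply] at this
  rw [this, fourierSeries]
  congr 1
  ext k
  simp only [hf', smul_apply, pairingCLM_apply, smul_eq_mul]
  ring

theorem RapidDecay.differentiable {c : ℤ × ℤ → ℂ} (hc : RapidDecay c) :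
    Differentiable ℂ (fourierSeries c) := fun x => by
  obtain ⟨f', h, -⟩ := hc.hasFDerivAt x
  exact h.differentiableAt

theorem RapidDecay.fderiv_apply {c : ℤ × ℤ → ℂ} (hc : RapidDecay c) (x v : Fin 2 → ℂ) :
    fderiv ℂ (fourierSeries c) x v =
      fourierSeries (fun k => 2 * Real.pi * I * (k.1 * v 0 + k.2 * v 1) * c k) x := by
  obtain ⟨f', h, h'⟩ := hc.hasFDerivAt x
  rw [h.fderiv, h']

theorem RapidDecay.differentiable_fderiv {c : ℤ × ℤ → ℂ} (hc : RapidDecay c) (v : Fin 2 → ℂ) :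
    Differentiable ℂ (fun x => fderiv ℂ (fourierSeries c) x v) := by
  simp_rw [hc.fderiv_apply]
  exact (hc.mul_pairing v).differentiable

/-- The exponential of a quadratic polynomial on `ℤ²` with symmetric circulant quadratic part. -/
noncomputable def gaussian (q₁ q₂ l₁ l₂ : ℂ) (k : ℤ × ℤ) : ℂ :=
  exp (Real.pi * I * (q₁ * (k.1 ^ 2 + k.2 ^ 2) + 2 * q₂ * k.1 * k.2) + l₁ * k.1 + l₂ * k.2)

theorem gaussian_ne_zero (q₁ q₂ l₁ l₂ : ℂ) (k : ℤ × ℤ) : gaussian q₁ q₂ l₁ l₂ k ≠ 0 :=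
  exp_ne_zero _

theorem norm_gaussian (q₁ q₂ l₁ l₂ : ℂ) (k : ℤ × ℤ) : ‖gaussian q₁ q₂ l₁ l₂ k‖ =
    Real.exp (-Real.pi * (q₁.im * (k.1 ^ 2 + k.2 ^ 2) + 2 * q₂.im * k.1 * k.2) +
      l₁.re * k.1 + l₂.re * k.2) := by
  have e : (Real.pi * I * (q₁ * (k.1 ^ 2 + k.2 ^ 2) + 2 * q₂ * k.1 * k.2) + l₁ * k.1 + l₂ * k.2 : ℂ)
      = ((Real.pi : ℝ) : ℂ) * (I * (q₁ * ((k.1 ^ 2 + k.2 ^ 2 : ℝ) : ℂ) +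
        q₂ * ((2 * k.1 * k.2 : ℝ) : ℂ))) + l₁ * ((k.1 : ℝ) : ℂ) + l₂ * ((k.2 : ℝ) : ℂ) := by
    push_cast
    ring
  rw [gaussian, norm_exp, e]
  congr 1
  simp only [add_re, re_ofReal_mul, I_mul_re, add_im, im_mul_ofReal, re_mul_ofReal]
  ring

/-- The imaginary part of the quadratic form has the eigenvalues Im q₁ ± Im q₂, hence is at least
d(x² + y²) with d = Im q₁ - |Im q₂|. The double sum is then dominated by a product of two
one-variable theta sums. -/
theorem rapidDecay_gaussian {q₁ q₂ : ℂ} (hq : |q₂.im| < q₁.im) (l₁ l₂ : ℂ) :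
    RapidDecay (gaussian q₁ q₂ l₁ l₂) := by
  intro R
  set d := q₁.im - |q₂.im| with hd
  have hd0 : 0 < d := sub_pos.2 hq
  have h1 : ∀ S : ℝ, Summable fun n : ℤ => Real.exp (-Real.pi * d * (n : ℝ) ^ 2 + S * |(n : ℝ)|) := by
    intro S
    have := summable_pow_mul_jacobiTheta₂_term_bound (S / (2 * Real.pi)) hd0 0
    refine this.congr fun n => ?_
    rw [pow_zero, one_mul]
    congr 1
    have := Real.pi_ne_zero
    push_cast
    field_simp
    ring
  refine ((h1 (|l₁.re| + R)).mul_of_nonneg (h1 (|l₂.re| + R)) (fun _ => (Real.exp_pos _).le)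
    (fun _ => (Real.exp_pos _).le)).of_nonneg_of_le (fun k => by positivity) fun k => ?_
  rw [norm_gaussian, ← Real.exp_add, ← Real.exp_add]
  refine Real.exp_le_exp.2 ?_
  have a1 : l₁.re * k.1 ≤ |l₁.re| * |(k.1 : ℝ)| := (le_abs_self _).trans (abs_mul _ _).le
  have a2 : l₂.re * k.2 ≤ |l₂.re| * |(k.2 : ℝ)| := (le_abs_self _).trans (abs_mul _ _).le
  have a3 : d * ((k.1 : ℝ) ^ 2 + (k.2 : ℝ) ^ 2) ≤
      q₁.im * ((k.1 : ℝ) ^ 2 + (k.2 : ℝ) ^ 2) + 2 * q₂.im * k.1 * k.2 := by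
    rcases abs_cases q₂.im with ⟨h, h'⟩ | ⟨h, h'⟩ <;> rw [hd, h]
    · nlinarith [mul_nonneg h' (sq_nonneg ((k.1 : ℝ) + k.2))]
    · nlinarith [mul_nonneg (neg_nonneg.2 h'.le) (sq_nonneg ((k.1 : ℝ) - k.2))]
  have a4 := mul_le_mul_of_nonneg_left a3 Real.pi_pos.le
  unfold l1norm
  linarith

end Series

end SpecialAbelianSurface

namespace SpecialAbelianSurface

open Filter Topology Complex

section QuasiPeriodic

/-! ### Quasi-periodic entire functions -/

/-- The subgroup of `ℤ²` generated by `(a, b)` and `(b, a)`. -/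
def circulantSubgroup (a b : ℤ) : AddSubgroup (ℤ × ℤ) where
  carrier := {k | ∃ m n : ℤ, k = (m * a + n * b, m * b + n * a)}
  zero_mem' := ⟨0, 0, by ext <;> simp⟩
  add_mem' := by
    rintro _ _ ⟨m, n, rfl⟩ ⟨m', n', rfl⟩
    exact ⟨m + m', n + n', by ext <;> simp <;> ring⟩
  neg_mem' := by
    rintro _ ⟨m, n, rfl⟩
    exact ⟨-m, -n, by ext <;> simp <;> ring⟩

/-- Coordinates on `circulantSubgroup a b`. -/
noncomputable def circulantEquiv {a b : ℤ} (h : a ^ 2 - b ^ 2 ≠ 0) :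
    circulantSubgroup a b ≃ₗ[ℤ] (Fin 2 → ℤ) :=
  LinearEquiv.symm <| LinearEquiv.ofBijective
    { toFun := fun c => (⟨(c 0 * a + c 1 * b, c 0 * b + c 1 * a), c 0, c 1, rfl⟩ :
        circulantSubgroup a b)
      map_add' := fun c d => Subtype.ext (by ext <;> simp <;> ring)
      map_smul' := fun r c => Subtype.ext (by ext <;> simp <;> ring) }
    (by
      constructor
      · rw [injective_iff_map_eq_zero]
        intro c hc
        have h1 : c 0 * a + c 1 * b = 0 :=
          congrArg (fun x : circulantSubgroup a b => (x : ℤ × ℤ).1) hc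
        have h2 : c 0 * b + c 1 * a = 0 :=
          congrArg (fun x : circulantSubgroup a b => (x : ℤ × ℤ).2) hc
        have e0 : c 0 * (a ^ 2 - b ^ 2) = 0 := by linear_combination a * h1 - b * h2
        have e1 : c 1 * (a ^ 2 - b ^ 2) = 0 := by linear_combination a * h2 - b * h1
        ext i
        fin_cases i
        · exact (mul_eq_zero.1 e0).resolve_right h
        · exact (mul_eq_zero.1 e1).resolve_right h
      · rintro ⟨_, m, n, rfl⟩
        exact ⟨![m, n], Subtype.ext (by simp)⟩)

theorem circulantEquiv_symm_apply {a b : ℤ} (h : a ^ 2 - b ^ 2 ≠ 0) (c : Fin 2 → ℤ) :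
    ((circulantEquiv h).symm c : ℤ × ℤ) = (c 0 * a + c 1 * b, c 0 * b + c 1 * a) := rfl

/-- The index of a sublattice is the absolute value of the determinant of a basis; this number
becomes the dimension of the space of sections. -/
theorem card_quotient_circulantSubgroup {a b : ℤ} (h : a ^ 2 - b ^ 2 ≠ 0) :
    Nat.card ((ℤ × ℤ) ⧸ circulantSubgroup a b) = (a ^ 2 - b ^ 2).natAbs := by
  have := AddSubgroup.index_eq_natAbs_det (Module.Basis.finTwoProd ℤ)
    (circulantSubgroup a b) (Module.Basis.ofEquivFun (circulantEquiv h))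
  rw [AddSubgroup.index] at this
  rw [this, Module.Basis.det_apply, Matrix.det_fin_two]
  congr 1
  simp [Module.Basis.toMatrix_apply, circulantEquiv_symm_apply]
  ring

theorem finite_quotient_circulantSubgroup {a b : ℤ} (h : a ^ 2 - b ^ 2 ≠ 0) :
    Finite ((ℤ × ℤ) ⧸ circulantSubgroup a b) := by
  refine Nat.finite_of_card_ne_zero ?_
  rw [card_quotient_circulantSubgroup h]
  simpa using h

/-- Periodic functions on `ℂ²` with the functional equations of theta functions under translation
by `(τ, z)` and `(z, τ)`. -/
structure IsQuasiPeriodic (a b : ℤ) (τ z μ₁ μ₂ : ℂ) (f : (Fin 2 → ℂ) → ℂ) : Prop where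
  periodic : IsPeriodic f
  fst : ∀ v, f (v + ![τ, z]) = exp μ₁ * expChar (-(a, b)) v * f v
  snd : ∀ v, f (v + ![z, τ]) = exp μ₂ * expChar (-(b, a)) v * f v

/-- The relations between the parameters of a Gaussian and of the functional equations. -/
structure GaussianData (a b : ℤ) (τ z μ₁ μ₂ q₁ q₂ l₁ l₂ : ℂ) : Prop where
  det_ne_zero : a ^ 2 - b ^ 2 ≠ 0
  im_lt : |q₂.im| < q₁.im
  q_fst : q₁ * a + q₂ * b = τ
  q_snd : q₁ * b + q₂ * a = z
  l_fst : l₁ * a + l₂ * b = -(μ₁ + Real.pi * I * (a * τ + b * z))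
  l_snd : l₁ * b + l₂ * a = -(μ₂ + Real.pi * I * (a * τ + b * z))

variable {a b : ℤ} {τ z μ₁ μ₂ q₁ q₂ l₁ l₂ : ℂ}

/-- The quadratic form sends (a, b) to (τ, z), so the cross term of the shift is the character at
(τ, z). The condition on `l₁` and `l₂` cancels the remaining constant against `μ₁`. -/
theorem GaussianData.gaussian_add_fst (D : GaussianData a b τ z μ₁ μ₂ q₁ q₂ l₁ l₂) (k : ℤ × ℤ) :
    exp μ₁ * gaussian q₁ q₂ l₁ l₂ (k + (a, b)) = expChar k ![τ, z] * gaussian q₁ q₂ l₁ l₂ k := by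
  rw [gaussian, gaussian, expChar, ← exp_add, ← exp_add]
  congr 1
  simp
  linear_combination (2 * Real.pi * I * k.1 + Real.pi * I * a) * D.q_fst +
    (2 * Real.pi * I * k.2 + Real.pi * I * b) * D.q_snd + D.l_fst

theorem GaussianData.gaussian_add_snd (D : GaussianData a b τ z μ₁ μ₂ q₁ q₂ l₁ l₂) (k : ℤ × ℤ) :
    exp μ₂ * gaussian q₁ q₂ l₁ l₂ (k + (b, a)) = expChar k ![z, τ] * gaussian q₁ q₂ l₁ l₂ k := by
  rw [gaussian, gaussian, expChar, ← exp_add, ← exp_add]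
  congr 1
  simp
  linear_combination (2 * Real.pi * I * k.2 + Real.pi * I * a) * D.q_fst +
    (2 * Real.pi * I * k.1 + Real.pi * I * b) * D.q_snd + D.l_snd

/-- The theta series with coefficients `φ` on the cosets of `circulantSubgroup a b`. -/
noncomputable def thetaSeries (q₁ q₂ l₁ l₂ : ℂ) (φ : (ℤ × ℤ) ⧸ circulantSubgroup a b → ℂ) :
    (Fin 2 → ℂ) → ℂ :=
  fourierSeries fun k => φ k * gaussian q₁ q₂ l₁ l₂ k

theorem GaussianData.rapidDecay (D : GaussianData a b τ z μ₁ μ₂ q₁ q₂ l₁ l₂)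
    (φ : (ℤ × ℤ) ⧸ circulantSubgroup a b → ℂ) :
    RapidDecay (fun k => φ k * gaussian q₁ q₂ l₁ l₂ k) := by
  have := finite_quotient_circulantSubgroup D.det_ne_zero
  obtain ⟨C, hC⟩ := (Set.finite_range fun x => ‖φ x‖).bddAbove
  exact (rapidDecay_gaussian D.im_lt l₁ l₂).mul_bounded fun k => hC ⟨k, rfl⟩

/-- Reindexing the series by `k ↦ k + d`; the converse passage is `fcoeff_recursion`. -/
theorem fourierSeries_add_of_recursion {c : ℤ × ℤ → ℂ} {w : Fin 2 → ℂ} {d : ℤ × ℤ} {r : ℂ}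
    (h : ∀ k, expChar k w * c k = r * c (k + d)) (v : Fin 2 → ℂ) :
    fourierSeries c (v + w) = r * expChar (-d) v * fourierSeries c v := by
  unfold fourierSeries
  rw [← tsum_mul_left, ← (Equiv.addRight d).tsum_eq
    (fun k => r * expChar (-d) v * (c k * expChar k v))]
  congr 1
  ext k
  simp only [Equiv.coe_addRight, expChar_add_right, expChar_add]
  linear_combination expChar k v * h k - r * c (k + d) * expChar k v * expChar_neg_mul d v

theorem circulant_fst_mem (a b : ℤ) : (a, b) ∈ circulantSubgroup a b := ⟨1, 0, by simp⟩

theorem circulant_snd_mem (a b : ℤ) : (b, a) ∈ circulantSubgroup a b := ⟨0, 1, by simp⟩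

theorem quotient_add_of_mem {S : AddSubgroup (ℤ × ℤ)} (k : ℤ × ℤ) {d : ℤ × ℤ} (hd : d ∈ S) :
    ((k + d : ℤ × ℤ) : (ℤ × ℤ) ⧸ S) = k := by
  rw [QuotientAddGroup.eq]
  simpa using hd

theorem GaussianData.isQuasiPeriodic (D : GaussianData a b τ z μ₁ μ₂ q₁ q₂ l₁ l₂)
    (φ : (ℤ × ℤ) ⧸ circulantSubgroup a b → ℂ) :
    IsQuasiPeriodic a b τ z μ₁ μ₂ (thetaSeries q₁ q₂ l₁ l₂ φ) where
  periodic := isPeriodic_fourierSeries _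
  fst := fourierSeries_add_of_recursion fun k => by
    rw [quotient_add_of_mem k (circulant_fst_mem a b)]
    linear_combination -φ k * D.gaussian_add_fst k
  snd := fourierSeries_add_of_recursion fun k => by
    rw [quotient_add_of_mem k (circulant_snd_mem a b)]
    linear_combination -φ k * D.gaussian_add_snd k

theorem fcoeff_recursion {f : (Fin 2 → ℂ) → ℂ} (hf : Differentiable ℂ f) (hp : IsPeriodic f)
    {w : Fin 2 → ℂ} {d : ℤ × ℤ} {r : ℂ} (h : ∀ v, f (v + w) = r * expChar (-d) v * f v)
    (k : ℤ × ℤ) : expChar k w * fcoeff f k = r * fcoeff f (k + d) := by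
  rw [← fcoeff_shift hf hp]
  simp_rw [h, mul_assoc]
  rw [fcoeff_const_mul, fcoeff_mul_expChar, sub_neg_eq_add]

/-- The Fourier coefficients of `f` and the Gaussian satisfy the same two recursions, so their
quotient is invariant under (a, b) and (b, a) and descends to the cosets. -/
theorem GaussianData.exists_eq_thetaSeries (D : GaussianData a b τ z μ₁ μ₂ q₁ q₂ l₁ l₂)
    {f : (Fin 2 → ℂ) → ℂ} (hf : Differentiable ℂ f) (h : IsQuasiPeriodic a b τ z μ₁ μ₂ f) :
    ∃ φ : (ℤ × ℤ) ⧸ circulantSubgroup a b → ℂ, f = thetaSeries q₁ q₂ l₁ l₂ φ := by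
  set g := gaussian q₁ q₂ l₁ l₂ with hg
  have hg0 : ∀ k, g k ≠ 0 := gaussian_ne_zero _ _ _ _
  set c : ℤ × ℤ → ℂ := fun k => fcoeff f k / g k with hc
  have c1 : ∀ k, c (k + (a, b)) = c k := by
    intro k
    have e1 := fcoeff_recursion hf h.periodic h.fst k
    have e2 := D.gaussian_add_fst k
    rw [hc, div_eq_div_iff (hg0 _) (hg0 _)]
    apply mul_left_cancel₀ (exp_ne_zero μ₁)
    linear_combination (-g k) * e1 - fcoeff f k * e2
  have c2 : ∀ k, c (k + (b, a)) = c k := by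
    intro k
    have e1 := fcoeff_recursion hf h.periodic h.snd k
    have e2 := D.gaussian_add_snd k
    rw [hc, div_eq_div_iff (hg0 _) (hg0 _)]
    apply mul_left_cancel₀ (exp_ne_zero μ₂)
    linear_combination (-g k) * e1 - fcoeff f k * e2
  let T : AddSubgroup (ℤ × ℤ) :=
    { carrier := {d | ∀ k, c (k + d) = c k}
      zero_mem' := by simp
      add_mem' := fun {d e} hd he k => by rw [← add_assoc, he, hd]
      neg_mem' := fun {d} hd k => by rw [← hd, neg_add_cancel_right] }
  have hT : circulantSubgroup a b ≤ T := by
    rintro _ ⟨m, n, rfl⟩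
    have := T.add_mem (T.zsmul_mem (x := (a, b)) c1 m) (T.zsmul_mem (x := (b, a)) c2 n)
    convert this using 1
    ext <;> simp
  refine ⟨Quotient.lift c fun k l hkl => ?_, ?_⟩
  · have := hT (QuotientAddGroup.leftRel_apply.1 hkl) k
    rw [← this, add_neg_cancel_left]
  · ext v
    refine sub_eq_zero.1 (eq_zero_of_fcoeff_eq_zero
      (hf.sub (D.rapidDecay _).differentiable) ⟨fun v => ?_, fun v => ?_⟩ (fun k => ?_) v)
    · simp only [h.periodic.1, (isPeriodic_fourierSeries _).1, Pi.sub_apply]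
    · simp only [h.periodic.2, (isPeriodic_fourierSeries _).2, Pi.sub_apply]
    · refine (fcoeff_sub hf (D.rapidDecay _).differentiable k).trans ?_
      rw [(D.rapidDecay _).fcoeff_fourierSeries]
      change _ - c k * g k = 0
      rw [hc]
      field_simp [hg0 k]
      simp

theorem GaussianData.fcoeff_thetaSeries (D : GaussianData a b τ z μ₁ μ₂ q₁ q₂ l₁ l₂)
    (φ : (ℤ × ℤ) ⧸ circulantSubgroup a b → ℂ) (k : ℤ × ℤ) :
    fcoeff (thetaSeries q₁ q₂ l₁ l₂ φ) k = φ k * gaussian q₁ q₂ l₁ l₂ k :=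
  (D.rapidDecay φ).fcoeff_fourierSeries k

theorem GaussianData.differentiable_thetaSeries (D : GaussianData a b τ z μ₁ μ₂ q₁ q₂ l₁ l₂)
    (φ : (ℤ × ℤ) ⧸ circulantSubgroup a b → ℂ) :
    Differentiable ℂ (thetaSeries q₁ q₂ l₁ l₂ φ) :=
  (D.rapidDecay φ).differentiable

theorem GaussianData.thetaSeries_add (D : GaussianData a b τ z μ₁ μ₂ q₁ q₂ l₁ l₂)
    (φ ψ : (ℤ × ℤ) ⧸ circulantSubgroup a b → ℂ) (v : Fin 2 → ℂ) :
    thetaSeries q₁ q₂ l₁ l₂ (φ + ψ) v =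
      thetaSeries q₁ q₂ l₁ l₂ φ v + thetaSeries q₁ q₂ l₁ l₂ ψ v := by
  refine HasSum.unique ((D.rapidDecay (φ + ψ)).hasSum v) ?_
  convert ((D.rapidDecay φ).hasSum v).add ((D.rapidDecay ψ).hasSum v) using 2
  · simp
    ring
  · rfl
  · rfl

theorem thetaSeries_smul (c : ℂ) (φ : (ℤ × ℤ) ⧸ circulantSubgroup a b → ℂ) (v : Fin 2 → ℂ) :
    thetaSeries q₁ q₂ l₁ l₂ (c • φ) v = c * thetaSeries q₁ q₂ l₁ l₂ φ v := by
  simp [thetaSeries, fourierSeries, ← tsum_mul_left, mul_assoc]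

end QuasiPeriodic

end SpecialAbelianSurface

namespace SpecialAbelianSurface

open Filter Topology Complex
open scoped ComplexConjugate

/-! ### Theta functions of an automorphic factor -/

section Theta

variable {L : AddSubgroup (Fin 2 → ℂ)}

/-- The entire functions with the automorphy of `J`. -/
def thetaSubmodule (J : AutomorphicFactor L) : Submodule ℂ ((Fin 2 → ℂ) → ℂ) where
  carrier := {θ | Differentiable ℂ θ ∧ ∀ (α : L) (v : Fin 2 → ℂ), θ (v + α) = J.toFun α v * θ v}
  zero_mem' := ⟨differentiable_const 0, by simp⟩
  add_mem' := by
    rintro f g ⟨hf, hf'⟩ ⟨hg, hg'⟩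
    exact ⟨hf.add hg, fun α v => by simp only [Pi.add_apply, hf', hg', mul_add]⟩
  smul_mem' := by
    rintro c f ⟨hf, hf'⟩
    exact ⟨hf.const_smul c, fun α v => by
      simp only [Pi.smul_apply, hf', smul_eq_mul, mul_left_comm]⟩

/-- The section of the line bundle that is defined by a function on `ℂ²`. -/
noncomputable def sectionOf (J : AutomorphicFactor L) (θ : (Fin 2 → ℂ) → ℂ)
    (x : (Fin 2 → ℂ) ⧸ L) : Fiber J x :=
  ⟨Quotient.mk (orbitSetoid J) (x.out, θ x.out), QuotientAddGroup.out_eq' x⟩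

theorem sectionOf_apply {J : AutomorphicFactor L} {θ : (Fin 2 → ℂ) → ℂ}
    (hθ : θ ∈ thetaSubmodule J) (v : Fin 2 → ℂ) : sectionOf J θ v = Fiber.mk J v (θ v) := by
  have hv : (v : (Fin 2 → ℂ) ⧸ L) = ((v : (Fin 2 → ℂ) ⧸ L).out : (Fin 2 → ℂ) ⧸ L) :=
    (QuotientAddGroup.out_eq' _).symm
  rw [QuotientAddGroup.eq] at hv
  refine Subtype.ext (Quotient.sound ((orbitSetoid J).symm ⟨⟨_, hv⟩, ?_⟩))
  simp only [← hθ.2 ⟨_, hv⟩ v, Prod.mk.injEq]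
  simp

theorem Fiber.mk_injective (J : AutomorphicFactor L) (v : Fin 2 → ℂ) :
    Function.Injective (Fiber.mk J v) := (Fiber.bijective J v v rfl).1

theorem Fiber.mk_add_lattice (J : AutomorphicFactor L) (v : Fin 2 → ℂ) (ξ : ℂ) (α : L) :
    (Fiber.mk J (v + α) (J.toFun α v * ξ)).1 = (Fiber.mk J v ξ).1 :=
  (Quotient.sound ⟨α, rfl⟩ : Quotient.mk (orbitSetoid J) (v, ξ) = _).symm

/-- The representatives `v` and `v + α` describe the same point of the same fibre, and coordinates
in a fibre are unique. -/
theorem mem_thetaSubmodule_of_section {J : AutomorphicFactor L} {θ : (Fin 2 → ℂ) → ℂ}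
    (hd : Differentiable ℂ θ) {s : (x : (Fin 2 → ℂ) ⧸ L) → Fiber J x}
    (hs : ∀ v : Fin 2 → ℂ, s v = Fiber.mk J v (θ v)) : θ ∈ thetaSubmodule J := by
  refine ⟨hd, fun α v => ?_⟩
  apply Fiber.mk_injective J (v + α)
  apply Subtype.ext
  rw [Fiber.mk_add_lattice, ← hs, ← hs]
  have : ((v + α : Fin 2 → ℂ) : (Fin 2 → ℂ) ⧸ L) = v := by
    rw [QuotientAddGroup.eq]
    simp
  rw [this]

/-- Holomorphic sections are theta functions. -/
noncomputable def thetaEquiv (J : AutomorphicFactor L) : thetaSubmodule J ≃ₗ[ℂ] H0 J :=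
  LinearEquiv.ofBijective
    { toFun := fun θ => ⟨sectionOf J θ.1, θ.1, θ.2.1, sectionOf_apply θ.2⟩
      map_add' := fun θ η => Subtype.ext (funext fun x => by
        induction x using QuotientAddGroup.induction_on with
        | H v =>
          simp only [Submodule.coe_add, Pi.add_apply, sectionOf_apply θ.2, sectionOf_apply η.2,
            ← Fiber.mk_add]
          exact (sectionOf_apply (θ + η).2 v))
      map_smul' := fun c θ => Subtype.ext (funext fun x => by
        induction x using QuotientAddGroup.induction_on with
        | H v =>
          simp only [Submodule.coe_smul, Pi.smul_apply, sectionOf_apply θ.2, ← Fiber.mk_smul,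
            RingHom.id_apply]
          exact (sectionOf_apply (c • θ).2 v)) }
    (by
      constructor
      · intro θ η h
        have h' : sectionOf J θ.1 = sectionOf J η.1 := congrArg Subtype.val h
        refine Subtype.ext (funext fun v => Fiber.mk_injective J v ?_)
        rw [← sectionOf_apply θ.2, ← sectionOf_apply η.2, h']
      · rintro ⟨s, θ, hd, hs⟩
        have hθ := mem_thetaSubmodule_of_section hd hs
        refine ⟨⟨θ, hθ⟩, Subtype.ext (funext fun x => ?_)⟩
        induction x using QuotientAddGroup.induction_on with
        | H v => exact (sectionOf_apply hθ v).trans (hs v).symm)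

theorem thetaEquiv_apply (J : AutomorphicFactor L) (θ : thetaSubmodule J) (v : Fin 2 → ℂ) :
    (thetaEquiv J θ).1 v = Fiber.mk J v (θ.1 v) := sectionOf_apply θ.2 v

theorem AutomorphicFactor.tensorPow_one (J : AutomorphicFactor L) : J.tensorPow 1 = J := by
  obtain ⟨f, h1, h2, h3⟩ := J
  simp [AutomorphicFactor.tensorPow]

/-- The functional equations of a theta function follow from those for the period basis. -/
theorem theta_of_generators {Ω : Matrix (Fin 2) (Fin 2) ℂ} (hΩ : Ω ∈ siegelUpperHalfPlane)
    (J : AutomorphicFactor (periodLattice Ω)) {θ : (Fin 2 → ℂ) → ℂ}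
    (h : ∀ i v, θ (v + periodVector Ω i) =
      J.toFun ⟨periodVector Ω i, periodVector_mem Ω i⟩ v * θ v)
    (α : periodLattice Ω) (v : Fin 2 → ℂ) : θ (v + α) = J.toFun α v * θ v := by
  let T : AddSubgroup (periodLattice Ω) :=
    { carrier := {α | ∀ v, θ (v + α) = J.toFun α v * θ v}
      zero_mem' := fun v => by simp [J.zero]
      add_mem' := fun {α β} hα hβ v => by
        rw [J.cocycle, mul_assoc, ← hβ v, add_comm (β : Fin 2 → ℂ), ← hα (v + β),
          AddSubgroup.coe_add, add_assoc, add_comm (β : Fin 2 → ℂ)]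
      neg_mem' := fun {α} hα v => by
        have h1 := hα (v + (-α : periodLattice Ω))
        have h2 := J.cocycle α (-α) v
        rw [add_neg_cancel, J.zero, add_comm ((-α : periodLattice Ω) : Fin 2 → ℂ)] at h2
        rw [AddSubgroup.coe_neg, neg_add_cancel_right] at h1
        rw [AddSubgroup.coe_neg] at h2 ⊢
        rw [h1]
        linear_combination θ (v + -(α : Fin 2 → ℂ)) * h2 }
  have hT : α ∈ T := by
    rw [← (periodBasis Ω hΩ).sum_repr α]
    refine T.sum_mem fun i _ => T.zsmul_mem ?_ _
    rw [periodBasis, Module.Basis.mk_apply]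
    exact h i
  exact hT v

end Theta

/-! ### Parametrization of the theta functions for `H_*` -/

section Parametrization

theorem HStar_apply (v w : Fin 2 → ℂ) : HStar v w =
    2 * v 0 * conj (w 0) + 2 * v 1 * conj (w 1) + v 0 * conj (w 1) + v 1 * conj (w 0) := rfl

/-- The exponential of a quadratic polynomial that relates theta functions to periodic
functions. -/
noncomputable def thetaPrefactor (n : ℕ) (r₁ r₂ : ℂ) (v : Fin 2 → ℂ) : ℂ :=
  exp (n * Real.pi * (v 0 ^ 2 + v 1 ^ 2 + v 0 * v 1) + 2 * Real.pi * I * (r₁ * v 0 + r₂ * v 1))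

theorem thetaPrefactor_ne_zero (n : ℕ) (r₁ r₂ : ℂ) (v : Fin 2 → ℂ) :
    thetaPrefactor n r₁ r₂ v ≠ 0 := exp_ne_zero _

theorem differentiable_thetaPrefactor (n : ℕ) (r₁ r₂ : ℂ) :
    Differentiable ℂ (thetaPrefactor n r₁ r₂) := by
  unfold thetaPrefactor
  fun_prop

theorem exists_exp_eq_pow {L : AddSubgroup (Fin 2 → ℂ)} {H : SesqForm} (χ : SemiCharacter L H)
    (α : L) (n : ℕ) : ∃ m : ℂ, (χ.toFun α : ℂ) ^ n = exp m :=
  ⟨log ((χ.toFun α : ℂ) ^ n), (exp_log (pow_ne_zero _ (Circle.coe_ne_zero _))).symm⟩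

variable {τ z : ℂ} {A B : ℤ}

/-- The linear systems have the circulant matrix with entries nA, nB, whose eigenvalues on (1, 1)
and (1, -1) are 3n(Im τ + Im z) and n(Im τ - Im z), both positive. Hence Im q₁ + Im q₂ = 1/(3n) and
Im q₁ - Im q₂ = 1/n, which gives the decay of the Gaussian. -/
theorem exists_gaussianData (hA : (2 * τ + z).im = A) (hB : (τ + 2 * z).im = B)
    (hpos : |z.im| < τ.im) {n : ℕ} (hn : 1 ≤ n) (μ₁ μ₂ : ℂ) :
    ∃ q₁ q₂ l₁ l₂, GaussianData (n * A) (n * B) τ z μ₁ μ₂ q₁ q₂ l₁ l₂ := by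
  simp at hA hB
  obtain ⟨hp1, hp2⟩ := abs_lt.1 hpos
  have hnR : (0 : ℝ) < n := by exact_mod_cast hn
  have hdR : (0 : ℝ) < (n * A) ^ 2 - (n * B) ^ 2 := by
    have : ((n * A : ℝ)) ^ 2 - (n * B) ^ 2 = n ^ 2 * (3 * ((τ.im - z.im) * (τ.im + z.im))) := by
      rw [← hA, ← hB]; ring
    rw [this]
    have h1 : 0 < τ.im - z.im := by linarith
    have h2 : 0 < τ.im + z.im := by linarith
    positivity
  have hdZ : ((n : ℤ) * A) ^ 2 - (n * B) ^ 2 ≠ 0 := by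
    have : (((((n : ℤ) * A) ^ 2 - (n * B) ^ 2 : ℤ)) : ℝ) ≠ 0 := by push_cast; exact hdR.ne'
    exact_mod_cast this
  have hdC : ((n : ℂ) * A) ^ 2 - (n * B) ^ 2 ≠ 0 := by exact_mod_cast hdZ
  have hsolve : ∀ r₁ r₂ : ℂ, ∃ x₁ x₂ : ℂ, x₁ * (n * A) + x₂ * (n * B) = r₁ ∧
      x₁ * (n * B) + x₂ * (n * A) = r₂ := by
    intro r₁ r₂
    refine ⟨(r₁ * (n * A) - r₂ * (n * B)) / ((n * A) ^ 2 - (n * B) ^ 2),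
      (r₂ * (n * A) - r₁ * (n * B)) / ((n * A) ^ 2 - (n * B) ^ 2), ?_, ?_⟩
    · rw [div_mul_eq_mul_div, div_mul_eq_mul_div, ← add_div, div_eq_iff hdC]
      ring
    · rw [div_mul_eq_mul_div, div_mul_eq_mul_div, ← add_div, div_eq_iff hdC]
      ring
  obtain ⟨q₁, q₂, hq1, hq2⟩ := hsolve τ z
  obtain ⟨l₁, l₂, hl1, hl2⟩ := hsolve (-(μ₁ + Real.pi * I * (n * A * τ + n * B * z)))
    (-(μ₂ + Real.pi * I * (n * A * τ + n * B * z)))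
  refine ⟨q₁, q₂, l₁, l₂, hdZ, ?_, by push_cast; exact hq1, by push_cast; exact hq2,
    by push_cast; exact hl1, by push_cast; exact hl2⟩
  have i1 : q₁.im * (n * A) + q₂.im * (n * B) = τ.im := by
    rw [← hq1]
    have e : q₁ * (n * A) + q₂ * (n * B) =
      q₁ * ((n * A : ℝ) : ℂ) + q₂ * ((n * B : ℝ) : ℂ) := by push_cast; ring
    rw [e, add_im, im_mul_ofReal, im_mul_ofReal]
  have i2 : q₁.im * (n * B) + q₂.im * (n * A) = z.im := by
    rw [← hq2]
    have e : q₁ * (n * B) + q₂ * (n * A) =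
      q₁ * ((n * B : ℝ) : ℂ) + q₂ * ((n * A : ℝ) : ℂ) := by push_cast; ring
    rw [e, add_im, im_mul_ofReal, im_mul_ofReal]
  have s1 : 0 < q₁.im + q₂.im := by
    refine (mul_pos_iff_of_pos_right (b := n * (3 * (τ.im + z.im))) ?_).1 ?_
    swap
    · have : (q₁.im + q₂.im) * (n * (3 * (τ.im + z.im))) = τ.im + z.im := by
        linear_combination i1 + i2 + (q₁.im + q₂.im) * n * (hA + hB)
      rw [this]
      linarith
    · have : 0 < τ.im + z.im := by linarith
      positivity
  have s2 : 0 < q₁.im - q₂.im := by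
    refine (mul_pos_iff_of_pos_right (b := n * (τ.im - z.im)) ?_).1 ?_
    swap
    · have : (q₁.im - q₂.im) * (n * (τ.im - z.im)) = τ.im - z.im := by
        linear_combination i1 - i2 + (q₁.im - q₂.im) * n * (hA - hB)
      rw [this]
      linarith
    · have : 0 < τ.im - z.im := by linarith
      positivity
  exact abs_lt.2 ⟨by linarith, by linarith⟩

/-- The quadratic part of the prefactor is nπ/2 times the ℂ-bilinear form that agrees with H_* when
the second argument is real. So it accounts for the factor of automorphy on ℤ², apart from the
semi-character. -/
theorem exists_thetaParameters (hΩ : !![τ, z; z, τ] ∈ siegelUpperHalfPlane)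
    (hA : (2 * τ + z).im = A) (hB : (τ + 2 * z).im = B)
    (hH : IsRiemannForm (periodLattice !![τ, z; z, τ]) HStar)
    (χ : SemiCharacter (periodLattice !![τ, z; z, τ]) HStar) (n : ℕ) :
    ∃ r₁ r₂ μ₁ μ₂ : ℂ, ∀ f : (Fin 2 → ℂ) → ℂ,
      (∀ (α : periodLattice !![τ, z; z, τ]) (v : Fin 2 → ℂ),
        thetaPrefactor n r₁ r₂ (v + α) * f (v + α) =
        ((automorphicFactor hH χ).tensorPow n).toFun α v * (thetaPrefactor n r₁ r₂ v * f v)) ↔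
      IsQuasiPeriodic (n * A) (n * B) τ z μ₁ μ₂ f := by
  set J := (automorphicFactor hH χ).tensorPow n with hJ
  have hJa : ∀ α v, J.toFun α v =
      (χ.toFun α : ℂ) ^ n * exp (n * (Real.pi * HStar v α + Real.pi / 2 * HStar α α)) := by
    intro α v
    rw [exp_nat_mul, ← mul_pow]
    rfl
  set e : Fin 4 → periodLattice !![τ, z; z, τ] :=
    fun i => ⟨periodVector !![τ, z; z, τ] i, periodVector_mem _ i⟩ with he
  choose m hm using fun i => exists_exp_eq_pow χ (e i) n
  have hAC : 2 * (τ.im : ℂ) + z.im = A := by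
    have : 2 * τ.im + z.im = A := by simpa using hA
    exact_mod_cast this
  have hBC : (τ.im : ℂ) + 2 * z.im = B := by
    have : τ.im + 2 * z.im = B := by simpa using hB
    exact_mod_cast this
  have hτ : conj τ = τ - 2 * I * τ.im := by
    have := sub_conj τ
    push_cast at this
    linear_combination -this
  have hz : conj z = z - 2 * I * z.im := by
    have := sub_conj z
    push_cast at this
    linear_combination -this
  have hpi := Real.pi_ne_zero
  -- The linear part of the prefactor absorbs the values of χⁿ at e₃ and e₄, so that `f` becomes
  -- strictly periodic.
  set r₁ : ℂ := m 2 / (2 * Real.pi * I) with hr1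
  set r₂ : ℂ := m 3 / (2 * Real.pi * I) with hr2
  have hm2 : m 2 = 2 * Real.pi * I * r₁ := by rw [hr1]; field_simp
  have hm3 : m 3 = 2 * Real.pi * I * r₂ := by rw [hr2]; field_simp
  have v0 : ((e 0 : periodLattice !![τ, z; z, τ]) : Fin 2 → ℂ) = ![τ, z] := by
    ext i; fin_cases i <;> simp [he, periodVector]
  have v1 : ((e 1 : periodLattice !![τ, z; z, τ]) : Fin 2 → ℂ) = ![z, τ] := by
    ext i; fin_cases i <;> simp [he, periodVector]
  have v2 : ((e 2 : periodLattice !![τ, z; z, τ]) : Fin 2 → ℂ) = ![1, 0] := by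
    ext i; fin_cases i <;> simp [he, periodVector]
  have v3 : ((e 3 : periodLattice !![τ, z; z, τ]) : Fin 2 → ℂ) = ![0, 1] := by
    ext i; fin_cases i <;> simp [he, periodVector]
  -- On e₁ and e₂ the Hermitian and the bilinear form differ through τ̄ - τ and z̄ - z. This
  -- produces the characters -(nA, nB) and -(nB, nA); the constants left over are `μ₁` and `μ₂`.
  set μ₁ : ℂ := m 0 - Real.pi * I * n * (τ * A + z * B) - 2 * Real.pi * I * (r₁ * τ + r₂ * z)
    with hμ1
  set μ₂ : ℂ := m 1 - Real.pi * I * n * (τ * A + z * B) - 2 * Real.pi * I * (r₁ * z + r₂ * τ)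
    with hμ2
  have k0 : ∀ v, J.toFun (e 0) v * thetaPrefactor n r₁ r₂ v =
      thetaPrefactor n r₁ r₂ (v + ![τ, z]) * (exp μ₁ * expChar (-(n * A, n * B)) v) := by
    intro v
    rw [hJa, hm, v0, thetaPrefactor, thetaPrefactor, expChar, ← exp_add, ← exp_add, ← exp_add,
      ← exp_add]
    congr 1
    simp [HStar_apply, hτ, hz]
    rw [hμ1, ← hAC, ← hBC]
    ring
  have k1 : ∀ v, J.toFun (e 1) v * thetaPrefactor n r₁ r₂ v =
      thetaPrefactor n r₁ r₂ (v + ![z, τ]) * (exp μ₂ * expChar (-(n * B, n * A)) v) := by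
    intro v
    rw [hJa, hm, v1, thetaPrefactor, thetaPrefactor, expChar, ← exp_add, ← exp_add, ← exp_add,
      ← exp_add]
    congr 1
    simp [HStar_apply, hτ, hz]
    rw [hμ2, ← hAC, ← hBC]
    ring
  have k2 : ∀ v, J.toFun (e 2) v * thetaPrefactor n r₁ r₂ v =
      thetaPrefactor n r₁ r₂ (v + ![1, 0]) := by
    intro v
    rw [hJa, hm, v2, thetaPrefactor, thetaPrefactor, ← exp_add, ← exp_add, hm2]
    congr 1
    simp [HStar_apply]
    ring
  have k3 : ∀ v, J.toFun (e 3) v * thetaPrefactor n r₁ r₂ v =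
      thetaPrefactor n r₁ r₂ (v + ![0, 1]) := by
    intro v
    rw [hJa, hm, v3, thetaPrefactor, thetaPrefactor, ← exp_add, ← exp_add, hm3]
    congr 1
    simp [HStar_apply]
    ring
  refine ⟨r₁, r₂, μ₁, μ₂, fun f => ⟨fun h => ?_, fun h => ?_⟩⟩
  · refine ⟨⟨fun v => ?_, fun v => ?_⟩, fun v => ?_, fun v => ?_⟩ <;>
      apply mul_left_cancel₀ (thetaPrefactor_ne_zero n r₁ r₂ _)
    · have := h (e 2) v
      rwa [← mul_assoc, k2, v2] at this
    · have := h (e 3) v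
      rwa [← mul_assoc, k3, v3] at this
    · have := h (e 0) v
      rwa [← mul_assoc, k0, v0, mul_assoc] at this
    · have := h (e 1) v
      rwa [← mul_assoc, k1, v1, mul_assoc] at this
  · refine theta_of_generators hΩ J (θ := fun v => thetaPrefactor n r₁ r₂ v * f v) fun i v => ?_
    change thetaPrefactor n r₁ r₂ (v + (e i : Fin 2 → ℂ)) * f (v + (e i : Fin 2 → ℂ)) =
      J.toFun (e i) v * (thetaPrefactor n r₁ r₂ v * f v)
    fin_cases i
    · change _ * f (v + (e 0 : Fin 2 → ℂ)) = J.toFun (e 0) v * _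
      rw [← mul_assoc, k0, mul_assoc, ← h.fst]
      simp only [← v0]
      rfl
    · change _ * f (v + (e 1 : Fin 2 → ℂ)) = J.toFun (e 1) v * _
      rw [← mul_assoc, k1, mul_assoc, ← h.snd]
      simp only [← v1]
      rfl
    · change _ * f (v + (e 2 : Fin 2 → ℂ)) = J.toFun (e 2) v * _
      rw [← mul_assoc, k2, ← h.periodic.1 v]
      simp only [← v2]
      rfl
    · change _ * f (v + (e 3 : Fin 2 → ℂ)) = J.toFun (e 3) v * _
      rw [← mul_assoc, k3, ← h.periodic.2 v]
      simp only [← v3]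
      rfl

/-- The theta functions of the `n`-th power of the factor of `H_*` are theta series. -/
theorem exists_thetaParametrization (hΩ : !![τ, z; z, τ] ∈ siegelUpperHalfPlane)
    (hA : (2 * τ + z).im = A) (hB : (τ + 2 * z).im = B) (hpos : |z.im| < τ.im)
    (hH : IsRiemannForm (periodLattice !![τ, z; z, τ]) HStar)
    (χ : SemiCharacter (periodLattice !![τ, z; z, τ]) HStar) {n : ℕ} (hn : 1 ≤ n) :
    ∃ r₁ r₂ μ₁ μ₂ q₁ q₂ l₁ l₂ : ℂ, GaussianData (n * A) (n * B) τ z μ₁ μ₂ q₁ q₂ l₁ l₂ ∧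
      ∃ e : ((ℤ × ℤ) ⧸ circulantSubgroup (n * A) (n * B) → ℂ) ≃ₗ[ℂ]
          thetaSubmodule ((automorphicFactor hH χ).tensorPow n),
        ∀ φ v, (e φ).1 v = thetaPrefactor n r₁ r₂ v * thetaSeries q₁ q₂ l₁ l₂ φ v := by
  obtain ⟨r₁, r₂, μ₁, μ₂, h⟩ := exists_thetaParameters hΩ hA hB hH χ n
  obtain ⟨q₁, q₂, l₁, l₂, D⟩ := exists_gaussianData hA hB hpos hn μ₁ μ₂
  refine ⟨r₁, r₂, μ₁, μ₂, q₁, q₂, l₁, l₂, D, ?_⟩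
  have hmem : ∀ φ, (fun v => thetaPrefactor n r₁ r₂ v * thetaSeries q₁ q₂ l₁ l₂ φ v) ∈
      thetaSubmodule ((automorphicFactor hH χ).tensorPow n) := fun φ =>
    ⟨(differentiable_thetaPrefactor _ _ _).mul (D.differentiable_thetaSeries φ),
      (h _).2 (D.isQuasiPeriodic φ)⟩
  refine ⟨LinearEquiv.ofBijective
    { toFun := fun φ => ⟨_, hmem φ⟩
      map_add' := fun φ ψ => Subtype.ext (funext fun v => ?_)
      map_smul' := fun c φ => Subtype.ext (funext fun v => ?_) } ⟨?_, ?_⟩, fun φ v => rfl⟩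
  · simp only [D.thetaSeries_add, mul_add]
    rfl
  · simp only [thetaSeries_smul, mul_left_comm _ c]
    rfl
  · intro φ ψ hφψ
    have h1 : thetaSeries q₁ q₂ l₁ l₂ φ = thetaSeries q₁ q₂ l₁ l₂ ψ := by
      ext v
      exact mul_left_cancel₀ (thetaPrefactor_ne_zero n r₁ r₂ v)
        (congrFun (congrArg Subtype.val hφψ) v)
    ext x
    induction x using QuotientAddGroup.induction_on with
    | H k =>
      apply mul_right_cancel₀ (gaussian_ne_zero q₁ q₂ l₁ l₂ k)
      rw [← D.fcoeff_thetaSeries, h1, D.fcoeff_thetaSeries]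
  · rintro ⟨θ, hθ, hθ'⟩
    set f : (Fin 2 → ℂ) → ℂ := fun v => (thetaPrefactor n r₁ r₂ v)⁻¹ * θ v with hf
    have hfθ : ∀ v, thetaPrefactor n r₁ r₂ v * f v = θ v := fun v =>
      mul_inv_cancel_left₀ (thetaPrefactor_ne_zero n r₁ r₂ v) _
    have hfd : Differentiable ℂ f :=
      ((differentiable_thetaPrefactor _ _ _).inv (thetaPrefactor_ne_zero n r₁ r₂)).mul hθ
    obtain ⟨φ, hφ⟩ := D.exists_eq_thetaSeries hfd ((h f).1 fun α v => by
      rw [hfθ, hfθ, hθ'])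
    refine ⟨φ, Subtype.ext (funext fun v => ?_)⟩
    change thetaPrefactor n r₁ r₂ v * thetaSeries q₁ q₂ l₁ l₂ φ v = θ v
    rw [← hφ, hfθ]

end Parametrization

end SpecialAbelianSurface

namespace SpecialAbelianSurface

open Filter Topology Complex
open scoped ComplexConjugate

/-! ### Products of translates of theta functions -/

section Translates

variable {L : AddSubgroup (Fin 2 → ℂ)} {H : SesqForm}

theorem automorphicFactor_add (hH : IsRiemannForm L H) (χ : SemiCharacter L H) (α : L)
    (v x : Fin 2 → ℂ) : (automorphicFactor hH χ).toFun α (v + x) =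
      (automorphicFactor hH χ).toFun α v * exp (Real.pi * H x α) := by
  change _ * exp _ = _ * exp _ * exp _
  rw [mul_assoc, ← exp_add]
  congr 2
  simp
  ring

theorem theta_translate {hH : IsRiemannForm L H} {χ : SemiCharacter L H} {θ : (Fin 2 → ℂ) → ℂ}
    (hθ : θ ∈ thetaSubmodule (automorphicFactor hH χ)) (α : L) (v x : Fin 2 → ℂ) :
    θ (v + α + x) =
      (automorphicFactor hH χ).toFun α v * exp (Real.pi * H x α) * θ (v + x) := by
  rw [add_right_comm, hθ.2, automorphicFactor_add]

/-- The product of translates of a theta function by vectors with sum zero. -/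
def translateProduct (θ : (Fin 2 → ℂ) → ℂ) (k : ℕ) (a b c : Fin 2 → ℂ) (v : Fin 2 → ℂ) : ℂ :=
  θ (v + a) * θ (v + b) * θ (v + (-((k : ℂ) • c) - a - b)) * θ (v + c) ^ k

/-- Translation by x multiplies the factor at α by exp(πH(x, α)). The k + 3 translation vectors add
up to zero, so these exponentials cancel. -/
theorem translateProduct_mem {hH : IsRiemannForm L H} {χ : SemiCharacter L H}
    {θ : (Fin 2 → ℂ) → ℂ} (hθ : θ ∈ thetaSubmodule (automorphicFactor hH χ)) (k : ℕ)
    (a b c : Fin 2 → ℂ) :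
    translateProduct θ k a b c ∈ thetaSubmodule ((automorphicFactor hH χ).tensorPow (k + 3)) := by
  have hd := hθ.1
  refine ⟨by unfold translateProduct; fun_prop, fun α v => ?_⟩
  have e : exp (Real.pi * H a α) * exp (Real.pi * H b α) *
      exp (Real.pi * H (-((k : ℂ) • c) - a - b) α) * exp (Real.pi * H c α) ^ k = 1 := by
    rw [← exp_nat_mul, ← exp_add, ← exp_add, ← exp_add, ← exp_zero]
    congr 1
    simp
    ring
  simp only [translateProduct, theta_translate hθ]
  change _ = (automorphicFactor hH χ).toFun α v ^ (k + 3) * _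
  rw [mul_pow, mul_pow, pow_add]
  linear_combination ((automorphicFactor hH χ).toFun α v ^ (k + 3) *
    (θ (v + a) * θ (v + b) * θ (v + (-((k : ℂ) • c) - a - b)) * θ (v + c) ^ k)) * e

/-- With a = b = c = y only θ(w + y) and θ(w - (k + 2)y) occur, two nonzero entire functions of y.
-/
theorem exists_theta_ne_zero {hH : IsRiemannForm L H} {χ : SemiCharacter L H}
    {θ : (Fin 2 → ℂ) → ℂ} (hθ : θ ∈ thetaSubmodule (automorphicFactor hH χ))
    (h0 : ∃ x, θ x ≠ 0) (k : ℕ) (w : Fin 2 → ℂ) :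
    ∃ T ∈ thetaSubmodule ((automorphicFactor hH χ).tensorPow (k + 3)), T w ≠ 0 := by
  have hd := hθ.1
  obtain ⟨x, hx⟩ := h0
  have d1 : Differentiable ℂ (fun y => θ (w + y)) := by fun_prop
  have d2 : Differentiable ℂ (fun y => θ (w + (-((k : ℂ) • y) - y - y))) := by fun_prop
  have hk : (-(k : ℂ) - 2) ≠ 0 := by
    have : ((k + 2 : ℕ) : ℂ) ≠ 0 := Nat.cast_ne_zero.2 (by omega)
    intro h
    apply this
    push_cast
    linear_combination -h
  obtain ⟨c, hc⟩ := exists_mul_ne_zero d1 d2 ⟨x - w, by simpa using hx⟩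
    ⟨(-(k : ℂ) - 2)⁻¹ • (x - w), by
      have : -((k : ℂ) • (-(k : ℂ) - 2)⁻¹ • (x - w)) - (-(k : ℂ) - 2)⁻¹ • (x - w) -
          (-(k : ℂ) - 2)⁻¹ • (x - w) = x - w := by
        ext i
        simp
        field_simp
        ring
      rw [this]
      simpa using hx⟩
  obtain ⟨h1, h2⟩ := mul_ne_zero_iff.1 hc
  exact ⟨_, translateProduct_mem hθ k c c c,
    mul_ne_zero (mul_ne_zero (mul_ne_zero h1 h1) h2) (pow_ne_zero _ h1)⟩

/-- For fixed `c` the hypothesis on translate products is a multiplicative functional equation in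
the free vectors `a` and `b`. -/
theorem theta_proportional_translates {hH : IsRiemannForm L H} {χ : SemiCharacter L H}
    {θ : (Fin 2 → ℂ) → ℂ} (hθ : θ ∈ thetaSubmodule (automorphicFactor hH χ))
    (h0 : ∃ x, θ x ≠ 0) {k : ℕ} {w w' : Fin 2 → ℂ} {r : ℂ}
    (h : ∀ T ∈ thetaSubmodule ((automorphicFactor hH χ).tensorPow (k + 3)), T w = r * T w') :
    ∃ (ℓ : (Fin 2 → ℂ) →L[ℂ] ℂ) (C : ℂ), C ≠ 0 ∧
      ∀ x, θ (w + x) = C * exp (ℓ x) * θ (w' + x) := by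
  have hd := hθ.1
  obtain ⟨x, hx⟩ := h0
  have d1 : Differentiable ℂ (fun y => θ (w + y)) := by fun_prop
  have d2 : Differentiable ℂ (fun y => θ (w' + y)) := by fun_prop
  have n1 : ∃ y, θ (w + y) ≠ 0 := ⟨x - w, by simpa using hx⟩
  have n2 : ∃ y, θ (w' + y) ≠ 0 := ⟨x - w', by simpa using hx⟩
  obtain ⟨c, hc⟩ := exists_mul_ne_zero d1 d2 n1 n2
  obtain ⟨h1, -⟩ := mul_ne_zero_iff.1 hc
  refine eq_exp_mul_of_mul_eq d1 d2 n1 n2 (-((k : ℂ) • c))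
    (r * θ (w' + c) ^ k / θ (w + c) ^ k) fun a b => ?_
  have := h _ (translateProduct_mem hθ k a b c)
  simp only [translateProduct] at this
  have hp := pow_ne_zero k h1
  rw [div_mul_eq_mul_div, eq_div_iff hp]
  linear_combination this

/-- The infinitesimal analogue: the logarithmic derivative of a translate product along `v` at `w`
is a sum over its factors and equals `r`, with the `k` factors at `c` contributing a constant. -/
theorem theta_affine_logDeriv {hH : IsRiemannForm L H} {χ : SemiCharacter L H}
    {θ : (Fin 2 → ℂ) → ℂ} (hθ : θ ∈ thetaSubmodule (automorphicFactor hH χ))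
    (h0 : ∃ x, θ x ≠ 0) {k : ℕ} {w v : Fin 2 → ℂ} {r : ℂ}
    (hv : Differentiable ℂ fun x => fderiv ℂ θ x v)
    (h : ∀ T ∈ thetaSubmodule ((automorphicFactor hH χ).tensorPow (k + 3)),
      fderiv ℂ T w v = r * T w) :
    ∃ (ℓ : (Fin 2 → ℂ) →L[ℂ] ℂ) (d : ℂ), ∀ x, fderiv ℂ θ x v = (ℓ x + d) * θ x := by
  have hd := hθ.1
  obtain ⟨x, hx⟩ := h0
  have d1 : Differentiable ℂ (fun y => θ (w + y)) := by fun_prop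
  have d2 : Differentiable ℂ (fun y => fderiv ℂ θ (w + y) v) :=
    hv.comp (differentiable_id.const_add w)
  have n1 : ∃ y, θ (w + y) ≠ 0 := ⟨x - w, by simpa using hx⟩
  obtain ⟨c, hc⟩ := n1
  obtain ⟨ℓ, d, hℓ⟩ := eq_affine_mul_of_add_eq d1 d2 ⟨c, hc⟩ (-((k : ℂ) • c))
    (r - k * (fderiv ℂ θ (w + c) v / θ (w + c))) fun a b => by
      have hT := h _ (translateProduct_mem hθ k a b c)
      have hs : ∀ y : Fin 2 → ℂ, HasFDerivAt (fun x => θ (x + y)) (fderiv ℂ θ (w + y)) w :=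
        fun y => (hd (w + y)).hasFDerivAt.comp w ((hasFDerivAt_id w).add_const y)
      have hder := (((hs a).mul (hs b)).mul (hs (-((k : ℂ) • c) - a - b))).mul ((hs c).pow k)
      have hfd : fderiv ℂ (translateProduct θ k a b c) w = _ := hder.fderiv
      rw [hfd] at hT
      simp [translateProduct] at hT
      -- The derivative of the `k`-th power contains the truncated exponent `k - 1`, so `k = 0` is
      -- separate.
      rcases k with _ | k
      · simp at hT ⊢
        linear_combination hT
      · simp only [Nat.add_sub_cancel] at hT
        push_cast at hT ⊢
        field_simp
        apply mul_left_cancel₀ (pow_ne_zero k hc)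
        linear_combination hT
  refine ⟨ℓ, d - ℓ w, fun x => ?_⟩
  have := hℓ (x - w)
  simp only [add_sub_cancel, map_sub] at this
  rw [this]
  ring

/-- Logarithmic differentiation of the automorphy equation along `v`: on passing from x to x + α the
affine function grows by ℓ(α), and the factor of automorphy contributes πH(v, α). -/
theorem linear_eq_of_affine_logDeriv {hH : IsRiemannForm L H} {χ : SemiCharacter L H}
    {θ : (Fin 2 → ℂ) → ℂ} (hθ : θ ∈ thetaSubmodule (automorphicFactor hH χ))
    (h0 : ∃ x, θ x ≠ 0) {v : Fin 2 → ℂ} {ℓ : (Fin 2 → ℂ) →L[ℂ] ℂ} {d : ℂ}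
    (h : ∀ x, fderiv ℂ θ x v = (ℓ x + d) * θ x) (α : L) : ℓ α = Real.pi * H v α := by
  obtain ⟨x, hx⟩ := h0
  set J := automorphicFactor hH χ with hJ
  have hline : HasDerivAt (fun t : ℂ => x + t • v) v 0 := by
    simpa using ((hasDerivAt_id (0 : ℂ)).smul_const v).const_add x
  have hθx : HasDerivAt (fun t : ℂ => θ (x + t • v)) (fderiv ℂ θ x v) 0 := by
    have h1 : HasFDerivAt θ (fderiv ℂ θ x) (x + (0 : ℂ) • v) := by
      simpa using (hθ.1 x).hasFDerivAt
    exact h1.comp_hasDerivAt 0 hline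
  have hθa : HasDerivAt (fun t : ℂ => θ (x + t • v + α)) (fderiv ℂ θ (x + α) v) 0 := by
    have h1 : HasFDerivAt θ (fderiv ℂ θ (x + α)) (x + (0 : ℂ) • v + α) := by
      simpa using (hθ.1 (x + α)).hasFDerivAt
    exact h1.comp_hasDerivAt 0 (hline.add_const _)
  have hJd : HasDerivAt (fun t : ℂ => J.toFun α (x + t • v))
      (J.toFun α x * (Real.pi * H v α)) 0 := by
    have h1 : ∀ t : ℂ, J.toFun α (x + t • v) = J.toFun α x * exp (t * (Real.pi * H v α)) := by
      intro t
      rw [hJ, automorphicFactor_add]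
      congr 2
      simp
      ring
    simp_rw [h1]
    have h2 := (((hasDerivAt_id (0 : ℂ)).mul_const ((Real.pi : ℂ) * H v α)).cexp).const_mul
      (J.toFun α x)
    simpa using h2
  have heq := hθa.unique ((hJd.mul hθx).congr_of_eventuallyEq
    (Eventually.of_forall fun t => hθ.2 α (x + t • v)))
  simp only [zero_smul, add_zero, h, hθ.2, map_add] at heq
  apply mul_right_cancel₀ (mul_ne_zero (J.ne_zero α x) hx)
  linear_combination heq

end Translates

/-! ### Separation of tangent vectors and of points. -/

section Separation

variable {τ z : ℂ} {A B : ℤ}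

theorem vec_mem_periodLattice (m n r s : ℤ) :
    (![m * τ + n * z + r, m * z + n * τ + s] : Fin 2 → ℂ) ∈ periodLattice !![τ, z; z, τ] := by
  refine ⟨![m, n], ![r, s], ?_⟩
  ext i
  fin_cases i <;> simp [Matrix.vecHead, Matrix.vecTail]

/-- A `ℂ`-linear form that agrees with `π H_*(v, ·)` on the lattice exists only for `v = 0`. -/
theorem eq_zero_of_linear_eq (hpos : |z.im| < τ.im) {v : Fin 2 → ℂ} {ℓ : (Fin 2 → ℂ) →L[ℂ] ℂ}
    (h : ∀ α : periodLattice !![τ, z; z, τ], ℓ α = Real.pi * HStar v α) : v = 0 := by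
  have hm : ∀ m n r s : ℤ, ℓ ![m * τ + n * z + r, m * z + n * τ + s] =
      Real.pi * HStar v ![m * τ + n * z + r, m * z + n * τ + s] := fun m n r s =>
    h ⟨_, vec_mem_periodLattice m n r s⟩
  have hl : ∀ s t : ℂ, ℓ ![s, t] = s * ℓ ![1, 0] + t * ℓ ![0, 1] := by
    intro s t
    rw [← smul_eq_mul, ← smul_eq_mul, ← map_smul, ← map_smul, ← map_add]
    congr 1
    ext i
    fin_cases i <;> simp
  have h2 := hm 0 0 1 0
  have h3 := hm 0 0 0 1
  have h0 := hm 1 0 0 0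
  have h1 := hm 0 1 0 0
  simp [HStar_apply] at h0 h1 h2 h3
  have hτ := sub_conj τ
  have hz := sub_conj z
  push_cast at hτ hz
  rw [hl, h2, h3] at h0 h1
  have hpi : (Real.pi : ℂ) * (2 * I) ≠ 0 := by simp [Real.pi_ne_zero]
  -- The periods e₃, e₄ determine `ℓ`; comparing with conjugates on e₁, e₂ shows that Im Ω kills (p,
  -- q) = Sv, S having the rows (2, 1) and (1, 2). Both matrices are invertible.
  set p := 2 * v 0 + v 1 with hp
  set q := 2 * v 1 + v 0 with hq
  have e0 : p * τ.im + q * z.im = 0 := by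
    apply mul_left_cancel₀ hpi
    rw [hp, hq]
    linear_combination h0 - Real.pi * (2 * v 0 + v 1) * hτ - Real.pi * (2 * v 1 + v 0) * hz
  have e1 : p * z.im + q * τ.im = 0 := by
    apply mul_left_cancel₀ hpi
    rw [hp, hq]
    linear_combination h1 - Real.pi * (2 * v 0 + v 1) * hz - Real.pi * (2 * v 1 + v 0) * hτ
  obtain ⟨hp1, hp2⟩ := abs_lt.1 hpos
  have hdR : (τ.im - z.im) * (τ.im + z.im) ≠ 0 :=
    mul_ne_zero (by linarith) (by linarith)
  have hd : ((τ.im : ℂ) - z.im) * (τ.im + z.im) ≠ 0 := by exact_mod_cast hdR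
  have p0 : p = 0 := by
    refine (mul_eq_zero.1 ?_).resolve_right hd
    linear_combination (τ.im : ℂ) * e0 - z.im * e1
  have q0 : q = 0 := by
    refine (mul_eq_zero.1 ?_).resolve_right hd
    linear_combination (τ.im : ℂ) * e1 - z.im * e0
  ext i
  fin_cases i
  · simp only [Fin.zero_eta, Pi.zero_apply]
    linear_combination (2 * p0 - q0 - 2 * hp + hq) / 3
  · simp only [Fin.mk_one, Pi.zero_apply]
    linear_combination (2 * q0 - p0 - 2 * hq + hp) / 3

theorem thetaPrefactor_add (n : ℕ) (r₁ r₂ : ℂ) (u : Fin 2 → ℂ) :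
    ∃ (ℓ : (Fin 2 → ℂ) →L[ℂ] ℂ) (C : ℂ), C ≠ 0 ∧
      ∀ y, thetaPrefactor n r₁ r₂ (y + u) = C * exp (ℓ y) * thetaPrefactor n r₁ r₂ y := by
  refine ⟨(n * Real.pi * (2 * u 0 + u 1) : ℂ) • ContinuousLinearMap.proj 0 +
    (n * Real.pi * (2 * u 1 + u 0) : ℂ) • ContinuousLinearMap.proj 1,
    thetaPrefactor n r₁ r₂ u, thetaPrefactor_ne_zero _ _ _ _, fun y => ?_⟩
  rw [thetaPrefactor, thetaPrefactor, thetaPrefactor, ← exp_add, ← exp_add]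
  congr 1
  simp
  ring

/-- Periodicity of both sides forces exp ∘ ℓ to be 1 on the two unit vectors. -/
theorem exists_exp_eq_expChar {f : (Fin 2 → ℂ) → ℂ} (hf : IsPeriodic f) (h0 : ∃ x, f x ≠ 0)
    {u : Fin 2 → ℂ} {ℓ : (Fin 2 → ℂ) →L[ℂ] ℂ} {C : ℂ} (hC : C ≠ 0)
    (h : ∀ y, f (y + u) = C * exp (ℓ y) * f y) : ∃ p, ∀ y, exp (ℓ y) = expChar p y := by
  obtain ⟨x, hx⟩ := h0
  have key : ∀ e : Fin 2 → ℂ, (∀ v, f (v + e) = f v) → exp (ℓ e) = 1 := by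
    intro e he
    have h1 := h (x + e)
    rw [add_right_comm, he, he, h, map_add, exp_add] at h1
    apply mul_left_cancel₀ (mul_ne_zero (mul_ne_zero hC (exp_ne_zero (ℓ x))) hx)
    linear_combination -h1
  obtain ⟨p, hp⟩ := exp_eq_one_iff.1 (key _ hf.1)
  obtain ⟨q, hq⟩ := exp_eq_one_iff.1 (key _ hf.2)
  refine ⟨(p, q), fun y => ?_⟩
  have hl : ℓ y = y 0 * ℓ ![1, 0] + y 1 * ℓ ![0, 1] := by
    rw [← smul_eq_mul, ← smul_eq_mul, ← map_smul, ← map_smul, ← map_add]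
    congr 1
    ext i
    fin_cases i <;> simp
  rw [hl, hp, hq, expChar]
  congr 1
  ring

/-- Up to a constant, an index shift by p costs the character at Qp, where Q has the rows (q₁, q₂)
and (q₂, q₁). -/
theorem gaussian_sub (q₁ q₂ l₁ l₂ : ℂ) (p : ℤ × ℤ) : ∃ G : ℂ, G ≠ 0 ∧ ∀ k,
    gaussian q₁ q₂ l₁ l₂ (k - p) * expChar k ![q₁ * p.1 + q₂ * p.2, q₂ * p.1 + q₁ * p.2] =
      G * gaussian q₁ q₂ l₁ l₂ k := by
  refine ⟨gaussian q₁ q₂ (-l₁) (-l₂) p, gaussian_ne_zero _ _ _ _ _, fun k => ?_⟩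
  rw [gaussian, gaussian, gaussian, expChar, ← exp_add, ← exp_add]
  congr 1
  simp
  ring

theorem exists_int_of_expChar_eq_one {k : ℤ × ℤ} {v : Fin 2 → ℂ} (h : expChar k v = 1) :
    ∃ m : ℤ, k.1 * v 0 + k.2 * v 1 = m := by
  obtain ⟨m, hm⟩ := exp_eq_one_iff.1 h
  refine ⟨m, mul_left_cancel₀ two_pi_I_ne_zero ?_⟩
  rw [hm]
  ring

variable {a b : ℤ} {μ₁ μ₂ q₁ q₂ l₁ l₂ : ℂ}

/-- If all theta series are multiplied by the exponential of an affine function under the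
translation by `u`, then `u` is in the lattice. -/
theorem GaussianData.mem_lattice (D : GaussianData a b τ z μ₁ μ₂ q₁ q₂ l₁ l₂) {u : Fin 2 → ℂ}
    (h : ∀ φ : (ℤ × ℤ) ⧸ circulantSubgroup a b → ℂ, (∃ x, thetaSeries q₁ q₂ l₁ l₂ φ x ≠ 0) →
      ∃ (ℓ : (Fin 2 → ℂ) →L[ℂ] ℂ) (C : ℂ), C ≠ 0 ∧ ∀ y,
        thetaSeries q₁ q₂ l₁ l₂ φ (y + u) = C * exp (ℓ y) * thetaSeries q₁ q₂ l₁ l₂ φ y) :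
    u ∈ periodLattice !![τ, z; z, τ] := by
  -- Comparison of Fourier coefficients: the exponential is a character with some index p, and
  -- cancelling the Gaussians leaves a relation between `φ` and its shift by p, twisted by the
  -- vector u + Qp.
  have key : ∀ φ : (ℤ × ℤ) ⧸ circulantSubgroup a b → ℂ, φ 0 = 1 → ∃ p : ℤ × ℤ, ∃ C : ℂ,
      ∀ k : ℤ × ℤ, expChar k (u + ![q₁ * p.1 + q₂ * p.2, q₂ * p.1 + q₁ * p.2]) * φ k =
        C * φ (k - p : ℤ × ℤ) := by
    intro φ hφ
    have hne : ∃ x, thetaSeries q₁ q₂ l₁ l₂ φ x ≠ 0 := by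
      by_contra! hz
      have := D.fcoeff_thetaSeries φ 0
      rw [show thetaSeries q₁ q₂ l₁ l₂ φ = fun _ => 0 from funext hz] at this
      simp [fcoeff, mean] at this
      exact this.elim (fun h => by rw [h] at hφ; exact zero_ne_one hφ) (gaussian_ne_zero _ _ _ _ _)
    obtain ⟨ℓ, C, hC, hℓ⟩ := h φ hne
    have hper := (D.isQuasiPeriodic φ).periodic
    obtain ⟨p, hp⟩ := exists_exp_eq_expChar hper hne hC hℓ
    obtain ⟨G, hG, hGk⟩ := gaussian_sub q₁ q₂ l₁ l₂ p
    refine ⟨p, C * G, fun k => ?_⟩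
    have e1 := fcoeff_shift (D.differentiable_thetaSeries φ) hper u k
    simp_rw [hℓ, hp, mul_assoc] at e1
    rw [fcoeff_const_mul, fcoeff_mul_expChar, D.fcoeff_thetaSeries, D.fcoeff_thetaSeries] at e1
    apply mul_left_cancel₀ (gaussian_ne_zero q₁ q₂ l₁ l₂ k)
    rw [expChar_add_right]
    linear_combination (-expChar k ![q₁ * p.1 + q₂ * p.2, q₂ * p.1 + q₁ * p.2]) * e1 +
      C * φ (k - p : ℤ × ℤ) * hGk k
  classical
  -- Two test functions suffice. The indicator of the trivial coset forces `p` into the subgroup and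
  -- makes u + Qp pair integrally with the subgroup. The constant function gives u + Qp' ∈ ℤ².
  obtain ⟨p, C, hp⟩ := key (fun x => if x = 0 then 1 else 0) (if_pos rfl)
  obtain ⟨p', C', hp'⟩ := key (fun _ => 1) rfl
  have hpS : p ∈ circulantSubgroup a b := by
    by_contra hpS
    have := hp 0
    have hne : ((0 - p : ℤ × ℤ) : (ℤ × ℤ) ⧸ circulantSubgroup a b) ≠ 0 := by
      rw [ne_eq, QuotientAddGroup.eq_zero_iff]
      simpa using hpS
    rw [if_neg hne, if_pos (by simp)] at this
    simp [expChar] at this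
  have hS : ∀ k ∈ circulantSubgroup a b,
      expChar k (u + ![q₁ * p.1 + q₂ * p.2, q₂ * p.1 + q₁ * p.2]) = C := by
    intro k hk
    have := hp k
    rwa [if_pos ((QuotientAddGroup.eq_zero_iff _).2 hk),
      if_pos ((QuotientAddGroup.eq_zero_iff _).2 (sub_mem hk hpS)), mul_one, mul_one] at this
  have hC1 : C = 1 := by
    rw [← hS 0 (zero_mem _)]
    simp [expChar]
  have hC1' : C' = 1 := by
    have := hp' 0
    simpa [expChar] using this.symm
  subst hC1 hC1'
  obtain ⟨m, n, rfl⟩ := hpS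
  -- For p in the subgroup, Qp is itself a lattice vector, so it remains to see that u + Qp is
  -- integral.
  have hQ1 : q₁ * ((m * a + n * b : ℤ) : ℂ) + q₂ * ((m * b + n * a : ℤ) : ℂ) = m * τ + n * z := by
    push_cast
    linear_combination m * D.q_fst + n * D.q_snd
  have hQ2 : q₂ * ((m * a + n * b : ℤ) : ℂ) + q₁ * ((m * b + n * a : ℤ) : ℂ) = m * z + n * τ := by
    push_cast
    linear_combination m * D.q_snd + n * D.q_fst
  simp only [hQ1, hQ2] at hS
  obtain ⟨s, hs⟩ := exists_int_of_expChar_eq_one (hS _ (circulant_fst_mem a b))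
  obtain ⟨t, ht⟩ := exists_int_of_expChar_eq_one (hS _ (circulant_snd_mem a b))
  obtain ⟨s', hs'⟩ := exists_int_of_expChar_eq_one (k := (1, 0)) (by simpa using hp' (1, 0))
  obtain ⟨t', ht'⟩ := exists_int_of_expChar_eq_one (k := (0, 1)) (by simpa using hp' (0, 1))
  simp at hs ht hs' ht'
  change u 0 + _ = _ at hs'
  change u 1 + _ = _ at ht'
  set x := u 0 + (m * τ + n * z) with hx
  set y := u 1 + (m * z + n * τ) with hy
  -- The integral pairings make u + Qp real, and u + Qp' is integral. So Im Q kills p - p', and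
  -- invertibility of Im Q gives p = p'.
  have hdR : ((a : ℝ) ^ 2 - b ^ 2) ≠ 0 := by exact_mod_cast D.det_ne_zero
  have im1 : a * x.im + b * y.im = 0 := by
    have := congrArg im hs
    simpa using this
  have im2 : b * x.im + a * y.im = 0 := by
    have := congrArg im ht
    simpa using this
  have hx0 : x.im = 0 := by
    refine (mul_eq_zero.1 ?_).resolve_left hdR
    linear_combination a * im1 - b * im2
  have hy0 : y.im = 0 := by
    refine (mul_eq_zero.1 ?_).resolve_left hdR
    linear_combination a * im2 - b * im1
  have d1 : x = s' + (q₁ * ((m * a + n * b - p'.1 : ℝ) : ℂ) +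
      q₂ * ((m * b + n * a - p'.2 : ℝ) : ℂ)) := by
    rw [hx]
    push_cast at hQ1 ⊢
    linear_combination hs' - hQ1
  have d2 : y = t' + (q₂ * ((m * a + n * b - p'.1 : ℝ) : ℂ) +
      q₁ * ((m * b + n * a - p'.2 : ℝ) : ℂ)) := by
    rw [hy]
    push_cast at hQ2 ⊢
    linear_combination ht' - hQ2
  have j1 := congrArg im d1
  have j2 := congrArg im d2
  rw [hx0, add_im, add_im, im_mul_ofReal, im_mul_ofReal, intCast_im, zero_add] at j1
  rw [hy0, add_im, add_im, im_mul_ofReal, im_mul_ofReal, intCast_im, zero_add] at j2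
  obtain ⟨b1, b2⟩ := abs_lt.1 D.im_lt
  have hq : (q₁.im - q₂.im) * (q₁.im + q₂.im) ≠ 0 :=
    mul_ne_zero (by linarith) (by linarith)
  have z1 : (m * a + n * b - p'.1 : ℝ) = 0 := by
    refine (mul_eq_zero.1 ?_).resolve_right hq
    linear_combination -q₁.im * j1 + q₂.im * j2
  have z2 : (m * b + n * a - p'.2 : ℝ) = 0 := by
    refine (mul_eq_zero.1 ?_).resolve_right hq
    linear_combination -q₁.im * j2 + q₂.im * j1
  rw [z1, z2] at d1 d2
  simp only [ofReal_zero, mul_zero, add_zero] at d1 d2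
  have := vec_mem_periodLattice (τ := τ) (z := z) (-m) (-n) s' t'
  convert this using 1
  ext i
  fin_cases i
  · simp
    linear_combination d1 - hx
  · simp
    linear_combination d2 - hy

end Separation

end SpecialAbelianSurface

namespace SpecialAbelianSurface

open Filter Topology Complex LinearAlgebra.Projectivization
open scoped ComplexConjugate

/-! ### Projective embeddings -/

section Projective

theorem continuous_projectivization_mk (N : ℕ) :
    Continuous (fun v : {v : Fin (N + 1) → ℂ // v ≠ 0} => Projectivization.mk ℂ v.1 v.2) :=
  continuous_coinduced_rng

/-- Complex projective space is a Hausdorff space. -/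
theorem t2Space_projectiveSpace (N : ℕ) : T2Space (ℙ ℂ (Fin (N + 1) → ℂ)) := by
  refine ⟨fun p q hpq => ?_⟩
  induction p using Projectivization.ind with | h u hu =>
  induction q using Projectivization.ind with | h v hv =>
  obtain ⟨i, hi⟩ : ∃ i, u i ≠ 0 := by
    by_contra! h
    exact hu (funext h)
  obtain ⟨j, hj⟩ : ∃ j, u i * v j - u j * v i ≠ 0 := by
    by_contra! h
    have hvi : v i ≠ 0 := by
      intro hvi
      refine hv (funext fun j => ?_)
      have := h j
      rw [hvi, mul_zero, sub_zero] at this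
      exact (mul_eq_zero.1 this).resolve_left hi
    refine hpq ((Projectivization.mk_eq_mk_iff' ℂ u v hu hv).2 ⟨u i / v i, ?_⟩)
    ext j
    rw [Pi.smul_apply, smul_eq_mul, div_mul_eq_mul_div, div_eq_iff hvi]
    linear_combination h j
  -- A 2×2 minor divided by the norm: it descends to a continuous function on projective space that
  -- vanishes at [u] and not at [v].
  set g : {w : Fin (N + 1) → ℂ // w ≠ 0} → ℝ :=
    fun w => ‖u i * w.1 j - u j * w.1 i‖ / ‖w.1‖ with hg
  have hgl : ∀ (a b : {w : Fin (N + 1) → ℂ // w ≠ 0}) (t : ℂ), (a : Fin (N + 1) → ℂ) = t • b →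
      g a = g b := by
    rintro ⟨a, ha⟩ ⟨b, hb⟩ t h
    simp only at h
    subst h
    have ht : t ≠ 0 := by
      rintro rfl
      simp at ha
    have e : u i * (t • b) j - u j * (t • b) i = t * (u i * b j - u j * b i) := by
      simp
      ring
    simp only [hg, e, norm_mul, norm_smul]
    rw [mul_div_mul_left _ _ (norm_ne_zero_iff.2 ht)]
  have hc : Continuous (Projectivization.lift g hgl) := by
    refine continuous_coinduced_dom.mpr ?_
    have : Continuous g := by
      refine Continuous.div ?_ (by fun_prop) fun w => norm_ne_zero_iff.2 w.2
      have h1 : ∀ i, Continuous fun w : {w : Fin (N + 1) → ℂ // w ≠ 0} => w.1 i := fun i =>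
        (continuous_apply i).comp continuous_subtype_val
      exact ((continuous_const.mul (h1 j)).sub (continuous_const.mul (h1 i))).norm
    exact this
  refine separated_by_continuous hc ?_
  rw [Projectivization.lift_mk, Projectivization.lift_mk]
  simp only [hg]
  rw [show u i * u j - u j * u i = 0 by ring, norm_zero, zero_div]
  exact (div_ne_zero (norm_ne_zero_iff.2 hj) (norm_ne_zero_iff.2 hv)).symm

variable {L : AddSubgroup (Fin 2 → ℂ)}

/-- Sections without common zeros that separate points and tangent vectors embed the torus. -/
theorem sectionsEmbed_of_separates [CompactSpace ((Fin 2 → ℂ) ⧸ L)] (J : AutomorphicFactor L)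
    {N : ℕ} (b : Module.Basis (Fin (N + 1)) ℂ (H0 J))
    (h0 : ∀ w, ∃ T ∈ thetaSubmodule J, T w ≠ 0)
    (h1 : ∀ w w' r, (∀ T ∈ thetaSubmodule J, T w = r * T w') → w - w' ∈ L)
    (h2 : ∀ w v r, (∀ T ∈ thetaSubmodule J, fderiv ℂ T w v = r * T w) → v = 0) :
    SectionsEmbed J := by
  refine ⟨N, ⟨b⟩, fun s => ?_⟩
  set t := s.map (thetaEquiv J).symm with ht
  set F : (Fin 2 → ℂ) → Fin (N + 1) → ℂ := fun v i => (t i).1 v with hF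
  have hs : ∀ i (v : Fin 2 → ℂ), (s i).1 v = Fiber.mk J v (F v i) := by
    intro i v
    rw [hF, ← thetaEquiv_apply]
    simp [ht]
  have hFd : Differentiable ℂ F := differentiable_pi.2 fun i => (t i).2.1
  have hspan : ∀ T ∈ thetaSubmodule J, ∃ c : Fin (N + 1) → ℂ, T = ∑ i, c i • (t i).1 := by
    intro T hT
    refine ⟨fun i => t.repr ⟨T, hT⟩ i, ?_⟩
    refine (congrArg Subtype.val (t.sum_repr ⟨T, hT⟩)).symm.trans ?_
    rw [Submodule.coe_sum]
    rfl
  have hF0 : ∀ v, F v ≠ 0 := by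
    intro v hv
    obtain ⟨T, hT, hTv⟩ := h0 v
    obtain ⟨c, rfl⟩ := hspan T hT
    apply hTv
    rw [Finset.sum_apply]
    exact Finset.sum_eq_zero fun i _ => by
      rw [Pi.smul_apply, show (t i).1 v = 0 from congrFun hv i, smul_zero]
  have hFα : ∀ (α : L) v, F (v + α) = J.toFun α v • F v := fun α v =>
    funext fun i => (t i).2.2 α v
  set φ : (Fin 2 → ℂ) ⧸ L → ℙ ℂ (Fin (N + 1) → ℂ) :=
    fun x => Projectivization.mk ℂ (F x.out) (hF0 _) with hφ
  have hφv : ∀ v : Fin 2 → ℂ, φ v = Projectivization.mk ℂ (F v) (hF0 v) := by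
    intro v
    have hv : (v : (Fin 2 → ℂ) ⧸ L) = ((v : (Fin 2 → ℂ) ⧸ L).out : (Fin 2 → ℂ) ⧸ L) :=
      (QuotientAddGroup.out_eq' _).symm
    rw [QuotientAddGroup.eq] at hv
    refine (Projectivization.mk_eq_mk_iff' ℂ _ _ _ _).2 ⟨J.toFun ⟨_, hv⟩ v, ?_⟩
    rw [← hFα]
    simp
  refine ⟨φ, fun x e => ?_, ?_, fun w => ⟨F, ?_, fun v hv => ?_⟩⟩
  · induction x using QuotientAddGroup.induction_on with | H v =>
    -- Every linear coordinate of the fibre is a nonzero multiple of ξ on [v, ξ], so the point of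
    -- projective space does not depend on it.
    have he : (fun i => e ((s i).1 v)) = e (Fiber.mk J v 1) • F v := by
      ext i
      rw [hs, Pi.smul_apply, smul_eq_mul, mul_comm, ← smul_eq_mul, ← map_smul, ← Fiber.mk_smul,
        mul_one]
    have he0 : e (Fiber.mk J v 1) ≠ 0 := by
      rw [ne_eq, e.map_eq_zero_iff, ← Fiber.mk_zero]
      exact fun h => one_ne_zero (Fiber.mk_injective J v h)
    have hne : (fun i => e ((s i).1 v)) ≠ 0 := by
      rw [he]
      exact smul_ne_zero he0 (hF0 v)
    refine ⟨hne, ?_⟩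
    rw [hφv]
    refine (Projectivization.mk_eq_mk_iff' ℂ _ _ _ _).2 ⟨(e (Fiber.mk J v 1))⁻¹, ?_⟩
    rw [he, inv_smul_smul₀ he0]
  · have hcont : Continuous φ := by
      refine (QuotientAddGroup.isQuotientMap_mk (N := L)).continuous_iff.2 ?_
      have e : φ ∘ QuotientAddGroup.mk =
          (fun v : {v : Fin (N + 1) → ℂ // v ≠ 0} => Projectivization.mk ℂ v.1 v.2) ∘
            fun v => ⟨F v, hF0 v⟩ := funext hφv
      rw [e]
      exact (continuous_projectivization_mk N).comp (hFd.continuous.subtype_mk _)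
    have hinj : Function.Injective φ := by
      intro x y hxy
      induction x using QuotientAddGroup.induction_on with | H v =>
      induction y using QuotientAddGroup.induction_on with | H w =>
      rw [hφv, hφv, Projectivization.mk_eq_mk_iff'] at hxy
      obtain ⟨r, hr⟩ := hxy
      rw [eq_comm, QuotientAddGroup.eq, neg_add_eq_sub]
      refine h1 v w r fun T hT => ?_
      obtain ⟨c, rfl⟩ := hspan T hT
      rw [Finset.sum_apply, Finset.sum_apply, Finset.mul_sum]
      refine Finset.sum_congr rfl fun i _ => ?_
      have : r * (t i).1 w = (t i).1 v := congrFun hr i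
      rw [Pi.smul_apply, Pi.smul_apply, ← this, smul_eq_mul, smul_eq_mul, mul_left_comm]
    -- A continuous injection of a compact space into a Hausdorff space is a closed embedding.
    have := t2Space_projectiveSpace N
    exact hcont.isClosedEmbedding hinj
  · exact Eventually.of_forall fun v => ⟨hFd v, hF0 v, hφv v⟩
  · obtain ⟨r, hr⟩ := hv
    refine h2 w v r fun T hT => ?_
    obtain ⟨c, rfl⟩ := hspan T hT
    have hd : HasFDerivAt (∑ i, c i • (t i).1) (∑ i, c i • fderiv ℂ (t i).1 w) w :=
      HasFDerivAt.sum fun i _ => ((t i).2.1 w).hasFDerivAt.const_smul (c i)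
    rw [hd.fderiv, Finset.sum_apply, Finset.mul_sum, _root_.sum_apply]
    refine Finset.sum_congr rfl fun i _ => ?_
    have h3 : fderiv ℂ F w v i = fderiv ℂ (t i).1 w v := by
      rw [fderiv_pi fun i => (t i).2.1 w]
      rfl
    have h4 := congrFun hr i
    rw [h3] at h4
    rw [smul_apply, h4, Pi.smul_apply, Pi.smul_apply, smul_eq_mul, smul_eq_mul, smul_eq_mul,
      mul_left_comm]

end Projective

/-! ### Compactness of the torus and arithmetic of H_*. -/

section Torus

variable {τ z : ℂ} {A B : ℤ}

theorem abs_im_lt_im (hΩ : !![τ, z; z, τ] ∈ siegelUpperHalfPlane) : |z.im| < τ.im := by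
  have h1 := hΩ.2.det_pos
  have h2 := hΩ.2.diag_pos (i := 0)
  rw [Matrix.det_fin_two] at h1
  simp at h1 h2
  exact abs_lt_of_sq_lt_sq (by nlinarith) h2.le

/-- Since Im Ω is invertible, every vector has real coordinates in the period basis; their
fractional parts show that the unit cube covers the torus. -/
theorem compactSpace_torus (hpos : |z.im| < τ.im) :
    CompactSpace ((Fin 2 → ℂ) ⧸ periodLattice !![τ, z; z, τ]) := by
  set p : (Fin 4 → ℝ) → (Fin 2 → ℂ) := fun c => ![c 0 * τ + c 1 * z + c 2, c 0 * z + c 1 * τ + c 3]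
    with hp
  have hpc : Continuous p := by
    refine continuous_pi fun i => ?_
    fin_cases i <;> simp [hp] <;> fun_prop
  have hc : Continuous fun c => (p c : (Fin 2 → ℂ) ⧸ periodLattice !![τ, z; z, τ]) :=
    continuous_quotient_mk'.comp hpc
  refine ⟨?_⟩
  convert (isCompact_Icc (a := (0 : Fin 4 → ℝ)) (b := 1)).image hc
  symm
  rw [Set.eq_univ_iff_forall]
  intro x
  induction x using QuotientAddGroup.induction_on with | H v =>
  obtain ⟨b1, b2⟩ := abs_lt.1 hpos
  have hd : τ.im ^ 2 - z.im ^ 2 ≠ 0 := by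
    have : 0 < (τ.im - z.im) * (τ.im + z.im) := mul_pos (by linarith) (by linarith)
    nlinarith
  obtain ⟨c, rfl⟩ : ∃ c, v = p c := by
    obtain ⟨x, y, h0, h1⟩ : ∃ x y : ℝ, x * τ.im + y * z.im = (v 0).im ∧
        x * z.im + y * τ.im = (v 1).im := by
      refine ⟨(τ.im * (v 0).im - z.im * (v 1).im) / (τ.im ^ 2 - z.im ^ 2),
        (τ.im * (v 1).im - z.im * (v 0).im) / (τ.im ^ 2 - z.im ^ 2), ?_, ?_⟩
      · rw [div_mul_eq_mul_div, div_mul_eq_mul_div, ← add_div, div_eq_iff hd]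
        ring
      · rw [div_mul_eq_mul_div, div_mul_eq_mul_div, ← add_div, div_eq_iff hd]
        ring
    refine ⟨![x, y, (v 0 - x * τ - y * z).re, (v 1 - x * z - y * τ).re], ?_⟩
    ext i
    fin_cases i
    · apply Complex.ext
      · simp [hp]
      · simp [hp, h0]
    · apply Complex.ext
      · simp [hp]
      · simp [hp, h1]
  have hf : ∀ i, ((Int.fract (c i) : ℝ) : ℂ) = c i - ⌊c i⌋ := by
    intro i
    rw [← Int.self_sub_floor]
    push_cast
    rfl
  refine ⟨fun i => Int.fract (c i), ⟨fun i => Int.fract_nonneg _, fun i => (Int.fract_lt_one _).le⟩,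
    ?_⟩
  rw [QuotientAddGroup.eq]
  convert vec_mem_periodLattice (τ := τ) (z := z) ⌊c 0⌋ ⌊c 1⌋ ⌊c 2⌋ ⌊c 3⌋ using 1
  ext i
  fin_cases i
  · simp [hp, hf]
    ring
  · simp [hp, hf]
    ring

/-- The terms pairing two rows of Ω are real, because Ω, its conjugate and the matrix of H_*
commute. The mixed terms involve the matrix of H_* times Im Ω, whose entries are A and B. -/
theorem HStar_im (hA : (2 * τ + z).im = A) (hB : (τ + 2 * z).im = B) (m n r s m' n' r' s' : ℤ) :
    (HStar ![m * τ + n * z + r, m * z + n * τ + s] ![m' * τ + n' * z + r', m' * z + n' * τ + s']).im =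
      (((m * r' + n * s') * A + (m * s' + n * r') * B -
        ((m' * r + n' * s) * A + (m' * s + n' * r) * B) : ℤ) : ℝ) := by
  push_cast
  rw [← hA, ← hB]
  simp [HStar_apply]
  ring

theorem exists_coordinates (α : Fin 2 → ℂ) (hα : α ∈ periodLattice !![τ, z; z, τ]) :
    ∃ m n r s : ℤ, α = ![m * τ + n * z + r, m * z + n * τ + s] := by
  obtain ⟨m, n, rfl⟩ := hα
  refine ⟨m 0, m 1, n 0, n 1, ?_⟩
  ext i
  fin_cases i <;> simp [Matrix.vecHead, Matrix.vecTail]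

theorem HStar_hermitian (v w : Fin 2 → ℂ) : HStar w v = conj (HStar v w) := by
  simp [HStar_apply, map_ofNat]
  ring

theorem isPositiveDefinite_HStar : IsPositiveDefinite HStar := by
  intro v hv
  have e : (HStar v v).re = (v 0).re ^ 2 + (v 0).im ^ 2 + ((v 1).re ^ 2 + (v 1).im ^ 2) +
      (((v 0).re + (v 1).re) ^ 2 + ((v 0).im + (v 1).im) ^ 2) := by
    simp [HStar_apply]
    ring
  rw [e]
  by_contra! h
  apply hv
  have a1 : (v 0).re = 0 := by nlinarith
  have a2 : (v 0).im = 0 := by nlinarith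
  have a3 : (v 1).re = 0 := by nlinarith
  have a4 : (v 1).im = 0 := by nlinarith
  ext i
  fin_cases i
  · exact Complex.ext a1 a2
  · exact Complex.ext a3 a4

theorem isRiemannForm_HStar (hA : (2 * τ + z).im = A) (hB : (τ + 2 * z).im = B) :
    IsRiemannForm (periodLattice !![τ, z; z, τ]) HStar where
  hermitian := HStar_hermitian
  nondegenerate := by
    have key : ∀ x, HStar x x = 0 → x = 0 := by
      intro x hx
      by_contra h
      have := isPositiveDefinite_HStar x h
      rw [hx] at this
      simp at this
    exact ⟨fun x hx => key x (hx x), fun x hx => key x (hx x)⟩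
  integral := by
    intro α hα β hβ
    obtain ⟨m, n, r, s, rfl⟩ := exists_coordinates α hα
    obtain ⟨m', n', r', s', rfl⟩ := exists_coordinates β hβ
    exact ⟨_, HStar_im hA hB _ _ _ _ _ _ _ _⟩

theorem coe_eq_repr (hΩ : !![τ, z; z, τ] ∈ siegelUpperHalfPlane)
    (α : periodLattice !![τ, z; z, τ]) :
    (α : Fin 2 → ℂ) =
      ![(periodBasis _ hΩ).repr α 0 * τ + (periodBasis _ hΩ).repr α 1 * z +
          (periodBasis _ hΩ).repr α 2,
        (periodBasis _ hΩ).repr α 0 * z + (periodBasis _ hΩ).repr α 1 * τ +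
          (periodBasis _ hΩ).repr α 3] := by
  conv_lhs => rw [← (periodBasis _ hΩ).sum_repr α]
  ext j
  simp only [periodBasis, Module.Basis.mk_apply]
  rw [periodVector_sum]
  fin_cases j <;> simp

theorem nonempty_semiCharacter (hΩ : !![τ, z; z, τ] ∈ siegelUpperHalfPlane)
    (hA : (2 * τ + z).im = A) (hB : (τ + 2 * z).im = B) :
    Nonempty (SemiCharacter (periodLattice !![τ, z; z, τ]) HStar) := by
  set c := (periodBasis _ hΩ).repr with hc
  set κ : periodLattice !![τ, z; z, τ] → ℤ := fun α =>
    (c α 0 * c α 2 + c α 1 * c α 3) * A + (c α 0 * c α 3 + c α 1 * c α 2) * B with hκ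
  refine ⟨fun α => Circle.exp (Real.pi * κ α), fun α β => ?_⟩
  rw [coe_eq_repr hΩ α, coe_eq_repr hΩ β, HStar_im hA hB, Circle.coe_exp, Circle.coe_exp,
    Circle.coe_exp, ← exp_add, ← exp_add, exp_eq_exp_iff_exists_int]
  -- κ(α + β) - κ(α) - κ(β) is the sum of the two mixed terms whose difference is E_*(α, β); the
  -- witness is the second of them.
  refine ⟨(c β 0 * c α 2 + c β 1 * c α 3) * A + (c β 0 * c α 3 + c β 1 * c α 2) * B, ?_⟩
  simp only [hκ, map_add, Finsupp.add_apply]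
  rw [← hc]
  push_cast
  ring

theorem imMatrix_det (hΩ : !![τ, z; z, τ] ∈ siegelUpperHalfPlane)
    (hA : (2 * τ + z).im = A) (hB : (τ + 2 * z).im = B) :
    (imMatrix HStar (periodBasis _ hΩ)).det = ((A : ℝ) ^ 2 - B ^ 2) ^ 2 := by
  have hE : imMatrix HStar (periodBasis _ hΩ) =
      !![0, 0, (A : ℝ), B; 0, 0, B, A; -A, -B, 0, 0; -B, -A, 0, 0] := by
    ext i j
    rw [imMatrix, Matrix.of_apply, coe_eq_repr hΩ (periodBasis _ hΩ i),
      coe_eq_repr hΩ (periodBasis _ hΩ j), HStar_im hA hB]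
    fin_cases i <;> fin_cases j <;> simp
  rw [hE]
  simp [Matrix.det_succ_row_zero, Fin.sum_univ_succ, Fin.succAbove]
  ring

end Torus

end SpecialAbelianSurface

namespace SpecialAbelianSurface

open Filter Topology Complex

/-! ### Embedding and dimension. -/

section Main

variable {τ z : ℂ} {A B : ℤ}

theorem differentiable_fderiv_thetaPrefactor (n : ℕ) (r₁ r₂ : ℂ) (v : Fin 2 → ℂ) :
    Differentiable ℂ fun x => fderiv ℂ (thetaPrefactor n r₁ r₂) x v := by
  have h : ContDiff ℂ 2 (thetaPrefactor n r₁ r₂) := by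
    unfold thetaPrefactor
    fun_prop
  have h1 : Differentiable ℂ (fderiv ℂ (thetaPrefactor n r₁ r₂)) :=
    (h.fderiv_right (m := 1) (by norm_num)).differentiable one_ne_zero
  exact h1.clm_apply (differentiable_const v)

theorem GaussianData.differentiable_fderiv_mul {a b : ℤ} {μ₁ μ₂ q₁ q₂ l₁ l₂ : ℂ}
    (D : GaussianData a b τ z μ₁ μ₂ q₁ q₂ l₁ l₂) (n : ℕ) (r₁ r₂ : ℂ)
    (φ : (ℤ × ℤ) ⧸ circulantSubgroup a b → ℂ) (v : Fin 2 → ℂ) :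
    Differentiable ℂ fun x => fderiv ℂ
      (fun y => thetaPrefactor n r₁ r₂ y * thetaSeries q₁ q₂ l₁ l₂ φ y) x v := by
  have d1 := differentiable_thetaPrefactor n r₁ r₂
  have d2 := D.differentiable_thetaSeries φ
  have e1 := differentiable_fderiv_thetaPrefactor n r₁ r₂ v
  have e2 : Differentiable ℂ fun x => fderiv ℂ (thetaSeries q₁ q₂ l₁ l₂ φ) x v :=
    (D.rapidDecay φ).differentiable_fderiv v
  have e : ∀ x, fderiv ℂ (fun y => thetaPrefactor n r₁ r₂ y * thetaSeries q₁ q₂ l₁ l₂ φ y) x v =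
      thetaPrefactor n r₁ r₂ x * fderiv ℂ (thetaSeries q₁ q₂ l₁ l₂ φ) x v +
        thetaSeries q₁ q₂ l₁ l₂ φ x * fderiv ℂ (thetaPrefactor n r₁ r₂) x v := by
    intro x
    rw [fderiv_fun_mul (d1 x) (d2 x)]
    rfl
  simp_rw [e]
  exact (d1.mul e2).add (d2.mul e1)

/-- The theta functions of the first power (`e`, `D`) do the separating; those of the `n`-th power
(`e'`, `D'`) only provide a finite nonempty basis. Points need all of the former, tangent vectors a
single nonzero one. -/
theorem sectionsEmbed_tensorPow (hΩ : !![τ, z; z, τ] ∈ siegelUpperHalfPlane)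
    (hA : (2 * τ + z).im = A) (hB : (τ + 2 * z).im = B)
    (hH : IsRiemannForm (periodLattice !![τ, z; z, τ]) HStar)
    (χ : SemiCharacter (periodLattice !![τ, z; z, τ]) HStar) {n : ℕ} (hn : 3 ≤ n) :
    SectionsEmbed ((automorphicFactor hH χ).tensorPow n) := by
  have hpos := abs_im_lt_im hΩ
  have := compactSpace_torus hpos
  have hpar := exists_thetaParametrization hΩ hA hB hpos hH χ le_rfl
  rw [AutomorphicFactor.tensorPow_one] at hpar
  obtain ⟨r₁, r₂, μ₁, μ₂, q₁, q₂, l₁, l₂, D, e, he⟩ := hpar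
  obtain ⟨_, _, _, _, _, _, _, _, D', e', -⟩ :=
    exists_thetaParametrization hΩ hA hB hpos hH χ (show 1 ≤ n by omega)
  have hfin := finite_quotient_circulantSubgroup D'.det_ne_zero
  obtain ⟨N, hN⟩ : ∃ N, Nat.card ((ℤ × ℤ) ⧸ circulantSubgroup (n * A) (n * B)) = N + 1 :=
    Nat.exists_eq_succ_of_ne_zero Nat.card_pos.ne'
  have basis : Module.Basis (Fin (N + 1)) ℂ (H0 ((automorphicFactor hH χ).tensorPow n)) :=
    ((Pi.basisFun ℂ _).map (e'.trans (thetaEquiv _))).reindex (Finite.equivFinOfCardEq hN)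
  have hne : ∃ x, (e fun _ => 1).1 x ≠ 0 := by
    by_contra! h
    have h0 : e (fun _ => 1) = 0 := Subtype.ext (funext h)
    rw [e.map_eq_zero_iff] at h0
    exact one_ne_zero (congrFun h0 0)
  obtain ⟨k, rfl⟩ : ∃ k, n = k + 3 := ⟨n - 3, by omega⟩
  refine sectionsEmbed_of_separates _ basis
    (fun w => exists_theta_ne_zero (e fun _ => 1).2 hne k w) (fun w w' r h => ?_)
    (fun w v r h => ?_)
  · refine D.mem_lattice fun φ hφ => ?_
    have hφ' : ∃ x, (e φ).1 x ≠ 0 := by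
      obtain ⟨x, hx⟩ := hφ
      refine ⟨x, ?_⟩
      rw [he]
      exact mul_ne_zero (thetaPrefactor_ne_zero _ _ _ _) hx
    obtain ⟨ℓ, C, hC, hℓ⟩ := theta_proportional_translates (e φ).2 hφ' h
    -- The prefactor also changes by the exponential of an affine function, so the proportionality
    -- passes from the theta functions to the theta series.
    obtain ⟨m, G, hG, hm⟩ := thetaPrefactor_add 1 r₁ r₂ (w - w')
    refine ⟨ℓ - m, C * exp (-ℓ w') / G, div_ne_zero (mul_ne_zero hC (exp_ne_zero _)) hG,
      fun y => ?_⟩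
    have h1 := hℓ (y - w')
    rw [show w + (y - w') = y + (w - w') by abel, add_sub_cancel, he, he, hm, map_sub] at h1
    rw [sub_apply, exp_sub, exp_neg]
    rw [exp_sub] at h1
    have h2 := thetaPrefactor_ne_zero 1 r₁ r₂ y
    have h3 := exp_ne_zero (ℓ w')
    have h4 := exp_ne_zero (m y)
    field_simp at h1 ⊢
    linear_combination h1
  · have hv : Differentiable ℂ fun x => fderiv ℂ (e fun _ => 1).1 x v := by
      rw [show (e fun _ => 1).1 = _ from funext (he _)]
      exact D.differentiable_fderiv_mul 1 r₁ r₂ _ v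
    obtain ⟨ℓ, d, hℓ⟩ := theta_affine_logDeriv (e fun _ => 1).2 hne hv h
    exact eq_zero_of_linear_eq hpos (linear_eq_of_affine_logDeriv (e fun _ => 1).2 hne hℓ)

theorem finiteDimensional_and_finrank_H0 (hΩ : !![τ, z; z, τ] ∈ siegelUpperHalfPlane)
    (hA : (2 * τ + z).im = A) (hB : (τ + 2 * z).im = B)
    (hH : IsRiemannForm (periodLattice !![τ, z; z, τ]) HStar)
    (χ : SemiCharacter (periodLattice !![τ, z; z, τ]) HStar) :
    FiniteDimensional ℂ (H0 (automorphicFactor hH χ)) ∧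
      Module.finrank ℂ (H0 (automorphicFactor hH χ)) = (A ^ 2 - B ^ 2).natAbs := by
  obtain ⟨_, _, _, _, _, _, _, _, D, e, -⟩ :=
    exists_thetaParametrization hΩ hA hB (abs_im_lt_im hΩ) hH χ le_rfl
  rw [AutomorphicFactor.tensorPow_one] at e
  have hfin := finite_quotient_circulantSubgroup D.det_ne_zero
  have := Fintype.ofFinite ((ℤ × ℤ) ⧸ circulantSubgroup ((1 : ℕ) * A) ((1 : ℕ) * B))
  have E := e.trans (thetaEquiv _)
  refine ⟨Module.Finite.equiv E, ?_⟩
  rw [← E.finrank_eq, Module.finrank_fintype_fun_eq_card, ← Nat.card_eq_fintype_card,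
    card_quotient_circulantSubgroup D.det_ne_zero]
  simp

end Main

end SpecialAbelianSurface

theorem theorem3p4 (τ z : ℂ) (hΩ : !![τ, z; z, τ] ∈ specialHalfSpace)
    (h₁ : ∃ k : ℤ, (2 * τ + z).im = k) (h₂ : ∃ k : ℤ, (τ + 2 * z).im = k) :
    ∃ hH : IsRiemannForm (periodLattice !![τ, z; z, τ]) HStar,
      IsPositiveDefinite HStar ∧
      Nonempty (SemiCharacter (periodLattice !![τ, z; z, τ]) HStar) ∧
      ∀ χ : SemiCharacter (periodLattice !![τ, z; z, τ]) HStar,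
        IsAmple (automorphicFactor hH χ) ∧
        (∀ n : ℕ, 3 ≤ n → SectionsEmbed ((automorphicFactor hH χ).tensorPow n)) ∧
        FiniteDimensional ℂ (H0 (automorphicFactor hH χ)) ∧
        (Module.finrank ℂ (H0 (automorphicFactor hH χ)) : ℝ) =
          √(imMatrix HStar (periodBasis !![τ, z; z, τ] hΩ.1)).det ∧
        √(imMatrix HStar (periodBasis !![τ, z; z, τ] hΩ.1)).det =
          3 * (τ.im ^ 2 - z.im ^ 2) := by
  obtain ⟨A, hA⟩ := h₁
  obtain ⟨B, hB⟩ := h₂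
  have hdet : (A : ℝ) ^ 2 - (B : ℝ) ^ 2 = 3 * (τ.im ^ 2 - z.im ^ 2) := by
    rw [← hA, ← hB]
    simp
    ring
  have hnn : 0 ≤ (A : ℝ) ^ 2 - (B : ℝ) ^ 2 := by
    obtain ⟨h1, h2⟩ := abs_lt.1 (abs_im_lt_im hΩ.1)
    rw [hdet]
    nlinarith
  have hsqrt : √(imMatrix HStar (periodBasis !![τ, z; z, τ] hΩ.1)).det =
      (A : ℝ) ^ 2 - (B : ℝ) ^ 2 := by
    rw [imMatrix_det hΩ.1 hA hB, Real.sqrt_sq hnn]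
  refine ⟨isRiemannForm_HStar hA hB, isPositiveDefinite_HStar,
    nonempty_semiCharacter hΩ.1 hA hB, fun χ => ?_⟩
  obtain ⟨hfin, hrank⟩ := finiteDimensional_and_finrank_H0 hΩ.1 hA hB _ χ
  refine ⟨⟨3, by norm_num, sectionsEmbed_tensorPow hΩ.1 hA hB _ χ le_rfl⟩,
    fun n hn => sectionsEmbed_tensorPow hΩ.1 hA hB _ χ hn, hfin, ?_, hsqrt.trans hdet⟩
  rw [hsqrt, hrank, Nat.cast_natAbs]
  push_cast
  exact abs_of_nonneg hnn
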